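/- Let $p>2$ be a prime, fix an algebraic closure $\mathbb Q_p^{\mathrm{alg}}$ of $\mathbb Q_p$, and write $g^{\circ n}$ for the $n$-fold iterate of a power series $g$ under composition, with $g^{\circ 0}=x$. Let $f,u\in\mathbb Z_p[[x]]$ be a minimal commuting pair, that is: $f(0)=u(0)=0$; $f'(0)\neq 0$ and $u'(0)\ne 0$; $f\circ u=u\circ f$; $f'(0)\notin\mathbb Z_p^\times$; $u'(0)\in\mathbb Z_p^\times$ and $u^{\circ n}\neq x$ for all $n\ge 1$; the reduction of $f$ modulo $p$ has order of vanishing exactly $p$ at $x=0$; and $v_p(f'(0))=v_p(u'(0)-1)=1$. For $n\ge 0$ let $\Lambda_f(n)$ be the set of $\pi\in\mathbb Q_p^{\mathrm{alg}}$ with $|\pi|<1$ and $f^{\circ n}(\pi)=0$, let $\Lambda_f=\bigcup_{n\ge 0}\Lambda_f(n)$, $K_n=\mathbb Q_p(\Lambda_f(n))$ and $K=\mathbb Q_p(\Lambda_f)$. Suppose that $\mathbb Q_p(\pi)/\mathbb Q_p$ is Galois for every $\pi\in\Lambda_f$. Then: (1) $K/\mathbb Q_p$ is Galois and $\mathfrak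 G=\mathrm{Gal}(K/\mathbb Q_p)$ is isomorphic, as a topological group, to $\mathbb Z/(p-1)\times\mathbb Z_p$; in particular $\mathfrak G$ is abelian. (2) For every $n\ge 1$, $K_n/\mathbb Q_p$ is Galois and $\mathfrak G_n=\mathrm{Gal}(K_n/\mathbb Q_p)\cong\mathbb Z/(p-1)\times\mathbb Z/p^{n-1}$. (3) $\mathfrak G$ has an element of order $p-1$, and there is a sequence $(\pi_n)_{n\ge 0}$ in $\Lambda_f$ with $\pi_0=0$, $\pi_1\ne 0$ and $f(\pi_{n+1})=\pi_n$ for all $n\geq 0$. For every such sequence there is a unique $\mathfrak u\in\mathfrak G$ with $\mathfrak u(\pi_n)=u(\pi_n)$ for all $n\ge 0$; and every $\mathfrak w\in\mathfrak G$ of order $p-1$ commutes with $\mathfrak u$, and there is an isomorphism of topological groups $\mathfrak G\to\mathbb Z/(p-1)\times\mathbb Z_p$ with $\mathfrak w\mapsto(1,0)$ and $\mathfrak u\mapsto(0,1)$. -/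

import Mathlib

open PowerSeries

noncomputable section

namespace CommutingPair

/-- Composition `g ∘ h` of power series; it is only applied when `h` has no constant term. -/
def comp {R : Type*} [CommRing R] (g h : R⟦X⟧) : R⟦X⟧ := PowerSeries.subst h g

/-- The `n`-fold iterate `g^{∘ n}` under composition, with `g^{∘ 0} = x`. -/
def iter {R : Type*} [CommRing R] (g : R⟦X⟧) : ℕ → R⟦X⟧
  | 0 => X
  | n + 1 => comp (iter g n) g

/-- The set `S₀(R)` of power series with `g(0) = 0` and `g'(0) ≠ 0`. -/
def S₀ (R : Type*) [CommRing R] : Set R⟦X⟧ :=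
  {g | coeff 0 g = 0 ∧ coeff 1 g ≠ 0}

/-- A commuting pair in `S₀(R)`: `f` is noninvertible, `u` is invertible and nontorsion under
composition, and `f ∘ u = u ∘ f`. -/
structure IsCommutingPair {R : Type*} [CommRing R] (f u : R⟦X⟧) : Prop where
  f_mem : f ∈ S₀ R
  u_mem : u ∈ S₀ R
  not_isUnit : ¬ IsUnit (coeff 1 f)
  isUnit : IsUnit (coeff 1 u)
  nontorsion : ∀ n : ℕ, 0 < n → iter u n ≠ X
  comm : comp f u = comp u f

variable {p : ℕ} [Fact p.Prime]

/-- The Weierstrass degree of a power series over `ℤ_p`: the order of its reduction mod `p`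
(which is `⊤` if the reduction vanishes). -/
def wideg (g : ℤ_[p]⟦X⟧) : ℕ∞ := (PowerSeries.map (PadicInt.toZMod (p := p)) g).order

/-- A minimal commuting pair over `ℤ_p`. -/
structure IsMinimalCommutingPair (f u : ℤ_[p]⟦X⟧) : Prop extends IsCommutingPair f u where
  wideg_eq : wideg f = p
  valuation_f : (coeff 1 f).valuation = 1
  valuation_u : (coeff 1 u - 1).valuation = if p = 2 then 2 else 1

/-- `g(x) = y`: the series `∑ aᵢ xⁱ` converges in the algebraic closure of `ℚ_p` (with the
`p`-adic topology) and its sum is `y`. -/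
def HasValueAt (g : ℤ_[p]⟦X⟧) (x y : PadicAlgCl p) : Prop :=
  HasSum (fun i : ℕ => algebraMap ℚ_[p] (PadicAlgCl p) (coeff i g : ℤ_[p]) * x ^ i) y

/-- `Λ_f(n)`: the roots of `f^{∘ n}` in the open unit disc of the algebraic closure of `ℚ_p`. -/
def Lam (f : ℤ_[p]⟦X⟧) (n : ℕ) : Set (PadicAlgCl p) :=
  {x | ‖x‖ < 1 ∧ HasValueAt (iter f n) x 0}

/-- `Λ_f`, the union of all `Λ_f(n)`. -/
def LamAll (f : ℤ_[p]⟦X⟧) : Set (PadicAlgCl p) := ⋃ n, Lam f n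

/-- `K_n = ℚ_p(Λ_f(n))`. -/
abbrev Kn (f : ℤ_[p]⟦X⟧) (n : ℕ) : IntermediateField ℚ_[p] (PadicAlgCl p) :=
  IntermediateField.adjoin ℚ_[p] (Lam f n)

/-- `K = ℚ_p(Λ_f)`. -/
abbrev K (f : ℤ_[p]⟦X⟧) : IntermediateField ℚ_[p] (PadicAlgCl p) :=
  IntermediateField.adjoin ℚ_[p] (LamAll f)

/-- An `f`-consistent sequence of elements of `Λ_f`. -/
structure IsConsistent (f : ℤ_[p]⟦X⟧) (π : ℕ → PadicAlgCl p) : Prop where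
  mem : ∀ n, π n ∈ LamAll f
  zero : π 0 = 0
  one_ne : π 1 ≠ 0
  step : ∀ n, HasValueAt f (π (n + 1)) (π n)

theorem IsConsistent.mem_K {f : ℤ_[p]⟦X⟧} {π : ℕ → PadicAlgCl p} (h : IsConsistent f π) (n : ℕ) :
    π n ∈ K f :=
  IntermediateField.subset_adjoin _ _ (h.mem n)

/-- The automorphism `σ` of `K` acts on the consistent sequence `π` through the series `u`:
`σ(π_n) = u(π_n)` for all `n`. -/
def ActsThrough {f : ℤ_[p]⟦X⟧} (u : ℤ_[p]⟦X⟧) {π : ℕ → PadicAlgCl p} (h : IsConsistent f π)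
    (σ : Gal(K f/ℚ_[p])) : Prop :=
  ∀ n, HasValueAt u (π n) (σ ⟨π n, h.mem_K n⟩ : K f)

end CommutingPair

end

open CommutingPair

/-!
The roots of `f^{∘ (n+1)}` that are not roots of `f^{∘ n}` are the roots of an Eisenstein polynomial
of degree `p ^ n * (p - 1)`. They are therefore conjugate uniformizers of totally ramified
extensions with residue field `𝔽_p`. Let `H_n` be the stabilizer of `π_{n+1}` in
`𝔊 = Gal(K/ℚ_p)`; by the Galois hypothesis it is normal of index `p ^ n * (p - 1)`. By conjugacy and
compactness some `𝔲 ∈ 𝔊` acts on the `π_n` through `u`. It lies in `H_0`, since `u` fixes `π_1`, and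
it generates `H_0` topologically: if `𝔲 ^ k` fixes `π_{n+1}`, Weierstrass division shows that
`p ^ (n + 1)` divides `u'(0) ^ k - 1`, hence `p ^ n` divides `k`. The quotient `𝔊 / H_0` is cyclic,
because `σ ↦ σ π_1 / π_1` modulo the maximal ideal embeds it into `𝔽_p^×`.

The crux is that an element `𝔴` of order dividing `p - 1` commutes with `𝔲`. One has
`‖𝔲 x - x‖ = ‖x‖ ^ p` for `x = π_2`, and as the residue field is `𝔽_p`, the residue of
`(𝔲 y - y) / y ^ p` is the same for all uniformizers `y` of `ℚ_p(π_2)`. Hence every conjugate of `𝔲`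
agrees with `𝔲` modulo `H_1`, so conjugation by `𝔴` raises `𝔲` to a power congruent to one modulo
`p`. The exponent is a `(p - 1)`-st root of unity in `ℤ_p`, so it is one, and `𝔊` is the completion
of the abelian group generated by `𝔴` and `𝔲`.
-/

namespace CommutingPair

/-! ### Ultrametric estimates -/

section Ultrametric

variable {L : Type*} [NormedField L] [IsUltrametricDist L]

theorem norm_add_lt {x y : L} {r : ℝ} (hx : ‖x‖ < r) (hy : ‖y‖ < r) : ‖x + y‖ < r :=
  (IsUltrametricDist.norm_add_le_max x y).trans_lt (max_lt hx hy)

theorem norm_sub_le_max (x y : L) : ‖x - y‖ ≤ max ‖x‖ ‖y‖ := by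
  simpa only [sub_eq_add_neg, norm_neg] using IsUltrametricDist.norm_add_le_max x (-y)

theorem norm_sub_lt {x y : L} {r : ℝ} (hx : ‖x‖ < r) (hy : ‖y‖ < r) : ‖x - y‖ < r :=
  (norm_sub_le_max x y).trans_lt (max_lt hx hy)

theorem norm_eq_of_norm_sub_lt {x y : L} (h : ‖x - y‖ < ‖y‖) : ‖x‖ = ‖y‖ := by
  have := IsUltrametricDist.norm_eq_of_add_norm_lt_max (x := x) (y := -y)
    (by simpa only [← sub_eq_add_neg, norm_neg] using lt_max_of_lt_right h)
  rwa [norm_neg] at this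

theorem norm_pow_sub_pow_le {x y : L} (hx : ‖x‖ ≤ 1) (hy : ‖y‖ ≤ 1) (n : ℕ) :
    ‖x ^ n - y ^ n‖ ≤ ‖x - y‖ := by
  rw [← geom_sum₂_mul, norm_mul]
  refine mul_le_of_le_one_left (norm_nonneg _) ?_
  refine IsUltrametricDist.norm_sum_le_of_forall_le_of_nonneg zero_le_one fun i _ => ?_
  rw [norm_mul, norm_pow, norm_pow]
  exact mul_le_one₀ (pow_le_one₀ (norm_nonneg _) hx) (by positivity)
    (pow_le_one₀ (norm_nonneg _) hy)

theorem norm_pow_sub_one {z : L} (hz : ‖z - 1‖ < 1) {n : ℕ} (hn : ‖(n : L)‖ = 1) :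
    ‖z ^ n - 1‖ = ‖z - 1‖ := by
  have hz1 : ‖z‖ = 1 := by rw [norm_eq_of_norm_sub_lt (y := 1) (by simpa using hz), norm_one]
  have hsum : ‖∑ i ∈ Finset.range n, z ^ i - (n : L)‖ < ‖(n : L)‖ := by
    have heq : ∑ i ∈ Finset.range n, z ^ i - (n : L) = ∑ i ∈ Finset.range n, (z ^ i - 1 ^ i) := by
      simp
    rw [heq, hn]
    refine (IsUltrametricDist.norm_sum_le_of_forall_le_of_nonneg (norm_nonneg _)
      fun i _ => ?_).trans_lt hz
    exact norm_pow_sub_pow_le hz1.le norm_one.le i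
  rw [← geom_sum_mul, norm_mul, norm_eq_of_norm_sub_lt hsum, hn, one_mul]

/-- Raising to a power prime to the residue characteristic is an isometry on each disc `1 + m`,
rescaled here to a disc around an arbitrary `y`. -/
theorem norm_pow_sub_pow {x y : L} (h : ‖x - y‖ < ‖y‖) {n : ℕ} (hn : ‖(n : L)‖ = 1) :
    ‖x ^ n - y ^ n‖ = ‖x - y‖ * ‖y‖ ^ (n - 1) := by
  have hy : 0 < ‖y‖ := (norm_nonneg _).trans_lt h
  have hy0 : y ≠ 0 := norm_pos_iff.mp hy
  have hn0 : n ≠ 0 := by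
    rintro rfl
    simp at hn
  have hxy : x / y - 1 = (x - y) / y := by rw [sub_div, div_self hy0]
  have hz : ‖x / y - 1‖ < 1 := by rwa [hxy, norm_div, div_lt_one hy]
  calc ‖x ^ n - y ^ n‖ = ‖(x / y) ^ n - 1‖ * ‖y‖ ^ n := by
        rw [← norm_pow, ← norm_mul, sub_mul, ← mul_pow, div_mul_cancel₀ _ hy0, one_mul]
    _ = ‖x - y‖ * ‖y‖ ^ (n - 1) := by
        rw [norm_pow_sub_one hz hn, hxy, norm_div, ← pow_sub_one_mul hn0]
        field_simp

end Ultrametric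

variable {p : ℕ} [Fact p.Prime]

theorem inv_prime_pos : 0 < (p : ℝ)⁻¹ := inv_pos.mpr (Nat.cast_pos.mpr (Fact.out : p.Prime).pos)

theorem inv_prime_lt_one : (p : ℝ)⁻¹ < 1 :=
  inv_lt_one_of_one_lt₀ (Nat.one_lt_cast.mpr (Fact.out : p.Prime).one_lt)

theorem norm_algebraMap_padicInt (a : ℤ_[p]) : ‖algebraMap ℤ_[p] (PadicAlgCl p) a‖ = ‖a‖ :=
  norm_algebraMap' (PadicAlgCl p) (a : ℚ_[p])

theorem norm_algebraMap_le_one (a : ℤ_[p]) : ‖algebraMap ℤ_[p] (PadicAlgCl p) a‖ ≤ 1 :=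
  (norm_algebraMap_padicInt a).trans_le a.2

theorem norm_natCast_prime : ‖(p : PadicAlgCl p)‖ = (p : ℝ)⁻¹ := by
  rw [← map_natCast (algebraMap ℤ_[p] (PadicAlgCl p)), norm_algebraMap_padicInt, PadicInt.norm_p]

theorem norm_natCast_eq_one {n : ℕ} (h : p.Coprime n) : ‖(n : PadicAlgCl p)‖ = 1 := by
  rw [← map_natCast (algebraMap ℤ_[p] (PadicAlgCl p)), norm_algebraMap_padicInt]
  exact PadicInt.norm_natCast_eq_one_iff.mpr h

theorem coprime_prime_sub_one : p.Coprime (p - 1) := by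
  have hp := (Fact.out : p.Prime).two_le
  exact ((Fact.out : p.Prime).coprime_iff_not_dvd).mpr
    (Nat.not_dvd_of_pos_of_lt (by omega) (by omega))

theorem norm_galois (σ : Gal(PadicAlgCl p/ℚ_[p])) (x : PadicAlgCl p) : ‖σ x‖ = ‖x‖ :=
  (spectralNorm_eq_of_equiv σ x).symm

/-! ### Evaluation of integral power series on the open unit disc -/

section Complete

variable {R F : Type*} [CommRing R] [NormedField F] {c : R →+* F} (hc : ∀ a, ‖c a‖ ≤ 1)

include hc

theorem summable_norm_coeff_mul_pow {x : F} (hx : ‖x‖ < 1) (g : R⟦X⟧) :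
    Summable fun i : ℕ => ‖c (coeff i g) * x ^ i‖ := by
  refine Summable.of_nonneg_of_le (fun _ => norm_nonneg _) (fun i => ?_)
    (summable_geometric_of_lt_one (norm_nonneg x) hx)
  rw [norm_mul, norm_pow]
  exact mul_le_of_le_one_left (by positivity) (hc _)

theorem tsum_coeff_mul_mul_pow [CompleteSpace F] {x : F} (hx : ‖x‖ < 1) (g h : R⟦X⟧) :
    ∑' i : ℕ, c (coeff i (g * h)) * x ^ i =
      (∑' i : ℕ, c (coeff i g) * x ^ i) * ∑' i : ℕ, c (coeff i h) * x ^ i := by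
  rw [tsum_mul_tsum_eq_tsum_sum_antidiagonal_of_summable_norm
    (summable_norm_coeff_mul_pow hc hx g) (summable_norm_coeff_mul_pow hc hx h)]
  refine tsum_congr fun n => ?_
  rw [coeff_mul, map_sum, Finset.sum_mul]
  refine Finset.sum_congr rfl fun kl hkl => ?_
  rw [← Finset.HasAntidiagonal.mem_antidiagonal.mp hkl, map_mul, pow_add]
  ring

end Complete

/-- The value `g(x)` of a power series at a point of the open unit disc; it is a junk value
elsewhere. -/
noncomputable def ev (x : PadicAlgCl p) (g : ℤ_[p]⟦X⟧) : PadicAlgCl p :=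
  ∑' i : ℕ, algebraMap ℤ_[p] (PadicAlgCl p) (coeff i g) * x ^ i

instance finiteDimensional_adjoin_singleton (x : PadicAlgCl p) :
    FiniteDimensional ℚ_[p] (IntermediateField.adjoin ℚ_[p] {x}) :=
  IntermediateField.adjoin.finiteDimensional (Algebra.IsIntegral.isIntegral x)

-- `PadicAlgCl p` is not complete, but each series converges in the finite extension `ℚ_p(x)`.
theorem exists_hasValueAt_adjoin {x : PadicAlgCl p} (hx : ‖x‖ < 1) :
    ∃ e : ℤ_[p]⟦X⟧ → IntermediateField.adjoin ℚ_[p] {x},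
      (∀ g, HasValueAt g x (e g)) ∧ ∀ g h, e (g * h) = e g * e h := by
  let E := IntermediateField.adjoin ℚ_[p] {x}
  have : CompleteSpace E := FiniteDimensional.complete ℚ_[p] E
  let c : ℤ_[p] →+* E := (algebraMap ℚ_[p] E).comp (algebraMap ℤ_[p] ℚ_[p])
  have hc : ∀ a, ‖c a‖ ≤ 1 := norm_algebraMap_le_one
  let xE : E := ⟨x, IntermediateField.mem_adjoin_simple_self ℚ_[p] x⟩
  have hxE : ‖xE‖ < 1 := hx
  refine ⟨fun g => ∑' i : ℕ, c (coeff i g) * xE ^ i, fun g => ?_, tsum_coeff_mul_mul_pow hc hxE⟩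
  exact (summable_norm_coeff_mul_pow hc hxE g).of_norm.hasSum.map (E.val : E →+ PadicAlgCl p)
    continuous_subtype_val

section

variable {x : PadicAlgCl p} (hx : ‖x‖ < 1)

include hx

theorem hasValueAt_ev (g : ℤ_[p]⟦X⟧) : HasValueAt g x (ev x g) := by
  obtain ⟨e, he, -⟩ := exists_hasValueAt_adjoin hx
  exact (he g).summable.hasSum

theorem hasValueAt_iff {g : ℤ_[p]⟦X⟧} {y : PadicAlgCl p} : HasValueAt g x y ↔ ev x g = y :=
  ⟨fun h => (hasValueAt_ev hx g).unique h, fun h => h ▸ hasValueAt_ev hx g⟩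

theorem ev_mem_adjoin (g : ℤ_[p]⟦X⟧) : ev x g ∈ IntermediateField.adjoin ℚ_[p] {x} := by
  obtain ⟨e, he, -⟩ := exists_hasValueAt_adjoin hx
  rw [(hasValueAt_iff hx).mp (he g)]
  exact (e g).2

theorem ev_mul (g h : ℤ_[p]⟦X⟧) : ev x (g * h) = ev x g * ev x h := by
  obtain ⟨e, he, hmul⟩ := exists_hasValueAt_adjoin hx
  simp only [fun g => (hasValueAt_iff hx).mp (he g), hmul]
  rfl

theorem ev_add (g h : ℤ_[p]⟦X⟧) : ev x (g + h) = ev x g + ev x h := by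
  refine (hasValueAt_iff hx).mp ?_
  have := HasSum.add (hasValueAt_ev hx g) (hasValueAt_ev hx h)
  simpa only [HasValueAt, map_add, PadicInt.coe_add, add_mul] using this

end

theorem ev_coe (x : PadicAlgCl p) (q : Polynomial ℤ_[p]) :
    ev x (q : ℤ_[p]⟦X⟧) = Polynomial.aeval x q := by
  rw [Polynomial.aeval_eq_sum_range, ev, tsum_eq_sum (s := Finset.range (q.natDegree + 1))]
  · simp only [Polynomial.coeff_coe, Algebra.smul_def]
  · intro i hi
    rw [Polynomial.coeff_coe, Polynomial.coeff_eq_zero_of_natDegree_lt (by simpa using hi),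
      map_zero, zero_mul]

@[simp] theorem ev_C (x : PadicAlgCl p) (a : ℤ_[p]) :
    ev x (C a) = algebraMap ℤ_[p] (PadicAlgCl p) a := by
  rw [← Polynomial.coe_C, ev_coe, Polynomial.aeval_C]

@[simp] theorem ev_X (x : PadicAlgCl p) : ev x X = x := by
  rw [← Polynomial.coe_X, ev_coe, Polynomial.aeval_X]

@[simp] theorem ev_one (x : PadicAlgCl p) : ev x 1 = 1 := by
  rw [← map_one (C (R := ℤ_[p])), ev_C, map_one]

theorem ev_zero_left (g : ℤ_[p]⟦X⟧) :
    ev 0 g = algebraMap ℤ_[p] (PadicAlgCl p) (coeff 0 g) := by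
  rw [ev, tsum_eq_single 0 fun i hi => by rw [zero_pow hi, mul_zero], pow_zero, mul_one]

/-- Evaluation at a point of the open unit disc, as a ring homomorphism. -/
noncomputable def evHom {x : PadicAlgCl p} (hx : ‖x‖ < 1) : ℤ_[p]⟦X⟧ →+* PadicAlgCl p where
  toFun := ev x
  map_one' := ev_one x
  map_mul' := ev_mul hx
  map_zero' := by rw [← map_zero (C (R := ℤ_[p])), ev_C, map_zero]
  map_add' := ev_add hx

theorem evHom_apply {x : PadicAlgCl p} (hx : ‖x‖ < 1) (g : ℤ_[p]⟦X⟧) : evHom hx g = ev x g := rfl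

theorem norm_ev_sub_ev_le {x y : PadicAlgCl p} (hx : ‖x‖ < 1) (hy : ‖y‖ < 1) (g : ℤ_[p]⟦X⟧) :
    ‖ev x g - ev y g‖ ≤ ‖x - y‖ := by
  have h := (hasValueAt_ev hx g).sub (hasValueAt_ev hy g)
  rw [← h.tsum_eq]
  refine IsUltrametricDist.norm_tsum_le_of_forall_le_of_nonneg (norm_nonneg _) fun i => ?_
  rw [← mul_sub, norm_mul]
  exact (mul_le_of_le_one_left (norm_nonneg _) (norm_algebraMap_le_one _)).trans
    (norm_pow_sub_pow_le hx.le hy.le i)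

section

variable {x : PadicAlgCl p} (hx : ‖x‖ < 1)

include hx

theorem ev_pow (g : ℤ_[p]⟦X⟧) (n : ℕ) : ev x (g ^ n) = ev x g ^ n := map_pow (evHom hx) g n

theorem norm_ev_le_one (g : ℤ_[p]⟦X⟧) : ‖ev x g‖ ≤ 1 := by
  refine IsUltrametricDist.norm_tsum_le_of_forall_le_of_nonneg zero_le_one fun i => ?_
  rw [norm_mul, norm_pow]
  exact mul_le_one₀ (norm_algebraMap_le_one _) (by positivity) (pow_le_one₀ (norm_nonneg _) hx.le)

theorem norm_ev_eq_one {g : ℤ_[p]⟦X⟧} (hg : IsUnit g) : ‖ev x g‖ = 1 := by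
  obtain ⟨h, hgh⟩ := hg.exists_right_inv
  refine (norm_ev_le_one hx g).antisymm ?_
  calc 1 = ‖ev x g‖ * ‖ev x h‖ := by rw [← norm_mul, ← ev_mul hx, hgh, ev_one, norm_one]
    _ ≤ ‖ev x g‖ := mul_le_of_le_one_right (norm_nonneg _) (norm_ev_le_one hx h)

theorem norm_ev_sub_coeff_zero_le (g : ℤ_[p]⟦X⟧) :
    ‖ev x g - algebraMap ℤ_[p] (PadicAlgCl p) (coeff 0 g)‖ ≤ ‖x‖ := by
  simpa only [ev_zero_left, sub_zero] using norm_ev_sub_ev_le hx (y := 0) (by simp) g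

theorem norm_ev_le {g : ℤ_[p]⟦X⟧} (hg : coeff 0 g = 0) : ‖ev x g‖ ≤ ‖x‖ := by
  simpa only [hg, map_zero, sub_zero] using norm_ev_sub_coeff_zero_le hx g

theorem norm_ev_lt_one {g : ℤ_[p]⟦X⟧} (hg : coeff 0 g = 0) : ‖ev x g‖ < 1 :=
  (norm_ev_le hx hg).trans_lt hx

end

-- No continuity of `φ` is assumed: it follows since `X ^ n` divides the `n`-th tail of a series.
theorem ringHom_eq_ev (φ : ℤ_[p]⟦X⟧ →+* PadicAlgCl p)
    (hC : ∀ a, φ (C a) = algebraMap ℤ_[p] (PadicAlgCl p) a) (hφ : ∀ g, ‖φ g‖ ≤ 1)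
    (hX : ‖φ X‖ < 1) (g : ℤ_[p]⟦X⟧) : φ g = ev (φ X) g := by
  have hpoly (q : Polynomial ℤ_[p]) : φ q = ev (φ X) (q : ℤ_[p]⟦X⟧) := by
    induction q using Polynomial.induction_on' with
    | add a b ha hb => rw [Polynomial.coe_add, map_add, ev_add hX, ha, hb]
    | monomial i a =>
      rw [ev_coe, Polynomial.aeval_monomial, ← Polynomial.C_mul_X_pow_eq_monomial,
        Polynomial.coe_mul, Polynomial.coe_pow, Polynomial.coe_C, Polynomial.coe_X, map_mul,
        map_pow, hC]
  have hle (n : ℕ) : ‖φ g - ev (φ X) g‖ ≤ ‖φ X‖ ^ n := by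
    rw [eq_X_pow_mul_shift_add_trunc n g, map_add, ev_add hX, hpoly, add_sub_add_right_eq_sub,
      map_mul, ev_mul hX, map_pow, ev_pow hX, ev_X, ← mul_sub, norm_mul, norm_pow]
    exact mul_le_of_le_one_right (by positivity)
      ((norm_sub_le_max _ _).trans (max_le (hφ _) (norm_ev_le_one hX _)))
  have hle_zero : ‖φ g - ev (φ X) g‖ ≤ 0 :=
    ge_of_tendsto' (tendsto_pow_atTop_nhds_zero_of_lt_one (norm_nonneg _) hX) hle
  exact sub_eq_zero.mp (norm_le_zero_iff.mp hle_zero)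

theorem ev_comp {x : PadicAlgCl p} (hx : ‖x‖ < 1) (g : ℤ_[p]⟦X⟧) {h : ℤ_[p]⟦X⟧}
    (hh : coeff 0 h = 0) : ev x (comp g h) = ev (ev x h) g := by
  have hs : HasSubst h := HasSubst.of_constantCoeff_zero' (by simpa using hh)
  let φ : ℤ_[p]⟦X⟧ →+* PadicAlgCl p :=
    (evHom hx).comp (substAlgHom (R := ℤ_[p]) hs : ℤ_[p]⟦X⟧ →+* ℤ_[p]⟦X⟧)
  have hφ (g) : φ g = ev x (comp g h) := by
    simp only [φ, comp, RingHom.comp_apply, RingHom.coe_coe, coe_substAlgHom, evHom_apply]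
  have hX : φ X = ev x h := by rw [hφ, comp, subst_X hs]
  rw [← hφ, ← hX]
  refine ringHom_eq_ev φ (fun a => ?_) (fun g => ?_) ?_ g
  · rw [hφ, comp, subst_C]
    exact ev_C x a
  · rw [hφ]
    exact norm_ev_le_one hx _
  · rw [hX]
    exact norm_ev_lt_one hx hh

theorem galois_ev (σ : Gal(PadicAlgCl p/ℚ_[p])) {x : PadicAlgCl p} (hx : ‖x‖ < 1)
    (g : ℤ_[p]⟦X⟧) : σ (ev x g) = ev (σ x) g := by
  have h := ringHom_eq_ev ((σ : PadicAlgCl p →+* PadicAlgCl p).comp (evHom hx))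
    (fun a => ?_) (fun g => ?_) ?_ g
  · simpa [evHom_apply] using h
  · rw [RingHom.comp_apply, evHom_apply, ev_C]
    exact σ.commutes (a : ℚ_[p])
  · simpa [evHom_apply, norm_galois] using norm_ev_le_one hx g
  · simpa [evHom_apply, norm_galois] using hx

/-! ### Composition and Weierstrass degree -/

section Comp

variable {R S : Type*} [CommRing R] [CommRing S]

theorem coeff_zero_mul (g h : R⟦X⟧) :
    coeff 0 (g * h) = coeff 0 g * coeff 0 h := by
  simp

/-- Composition `g ↦ g ∘ h` with a fixed series without constant term, as a ring homomorphism. -/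
noncomputable def compHom {h : R⟦X⟧} (hh : coeff 0 h = 0) : R⟦X⟧ →+* R⟦X⟧ :=
  (substAlgHom (R := R) (HasSubst.of_constantCoeff_zero' (a := h) (by simpa using hh)) :
    R⟦X⟧ →+* R⟦X⟧)

section

variable {h : R⟦X⟧} (hh : coeff 0 h = 0)

theorem compHom_apply (g : R⟦X⟧) : compHom hh g = comp g h := by
  simp only [compHom, comp, RingHom.coe_coe, coe_substAlgHom]

@[simp] theorem compHom_X : compHom hh X = h := by
  rw [compHom_apply, comp, subst_X (HasSubst.of_constantCoeff_zero' (by simpa using hh))]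

@[simp] theorem compHom_C (r : R) : compHom hh (C r) = C r := by
  rw [compHom_apply]
  exact subst_C r

include hh

theorem coeff_zero_comp (g : R⟦X⟧) : coeff 0 (comp g h) = coeff 0 g := by
  have hh' : constantCoeff h = 0 := by simpa using hh
  conv_lhs => rw [eq_X_mul_shift_add_const g, ← compHom_apply hh, map_add, map_mul, compHom_X,
    compHom_C]
  simp [hh']

theorem map_comp (φ : R →+* S) (g : R⟦X⟧) : (comp g h).map φ = comp (g.map φ) (h.map φ) :=
  map_subst (HasSubst.of_constantCoeff_zero' (by simpa using hh)) g

theorem order_comp [IsDomain R] (g : R⟦X⟧) : (comp g h).order = g.order * h.order := by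
  rcases eq_or_ne g 0 with rfl | hg
  · have hpos : h.order ≠ 0 := by simpa [order_ne_zero_iff_constCoeff_eq_zero] using hh
    rw [← compHom_apply hh, map_zero, order_zero, ENat.top_mul hpos]
  have hw : (comp (divXPowOrder g) h).order = 0 := by
    rw [← not_ne_iff, order_ne_zero_iff_constCoeff_eq_zero, ← coeff_zero_eq_constantCoeff_apply,
      coeff_zero_comp hh, coeff_zero_eq_constantCoeff_apply,
      constantCoeff_divXPowOrder_eq_zero_iff]
    exact hg
  conv_lhs => rw [← X_pow_order_mul_divXPowOrder (f := g), ← compHom_apply hh, map_mul, map_pow,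
    compHom_X, order_mul, order_pow, compHom_apply, hw, add_zero, nsmul_eq_mul, coe_toNat_order hg]

theorem coeff_zero_iter (n : ℕ) : coeff 0 (iter h n) = 0 := by
  induction n with
  | zero => exact coeff_zero_X
  | succ n ih => rw [iter, coeff_zero_comp hh, ih]

end

theorem order_map_eq_of_ker_eq {T : Type*} [CommRing T] {φ : R →+* S} {ψ : R →+* T}
    (h : RingHom.ker φ = RingHom.ker ψ) (g : R⟦X⟧) : (g.map φ).order = (g.map ψ).order := by
  have hcoeff (i : ℕ) : coeff i (g.map φ) = 0 ↔ coeff i (g.map ψ) = 0 := by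
    rw [coeff_map, coeff_map, ← RingHom.mem_ker, h, RingHom.mem_ker]
  exact le_antisymm (le_order _ _ fun i hi => (hcoeff i).mp (coeff_of_lt_order i hi))
    (le_order _ _ fun i hi => (hcoeff i).mpr (coeff_of_lt_order i hi))

end Comp

theorem order_map_residue (g : ℤ_[p]⟦X⟧) :
    (g.map (IsLocalRing.residue ℤ_[p])).order = wideg g :=
  order_map_eq_of_ker_eq (by rw [IsLocalRing.ker_residue, PadicInt.ker_toZMod]) g

theorem wideg_X_mul (g : ℤ_[p]⟦X⟧) : wideg (X * g) = 1 + wideg g := by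
  rw [wideg, map_mul, map_X, order_mul, order_X, wideg]

theorem wideg_comp {h : ℤ_[p]⟦X⟧} (hh : coeff 0 h = 0) (g : ℤ_[p]⟦X⟧) :
    wideg (comp g h) = wideg g * wideg h := by
  rw [wideg, map_comp hh, order_comp (by rw [coeff_map, hh, map_zero]), wideg, wideg]

theorem wideg_iter {g : ℤ_[p]⟦X⟧} (hg : coeff 0 g = 0) (n : ℕ) :
    wideg (iter g n) = wideg g ^ n := by
  induction n with
  | zero => rw [iter, wideg, map_X, order_X, pow_zero]
  | succ n ih => rw [iter, wideg_comp hg, ih, pow_succ]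

theorem ev_iter {g : ℤ_[p]⟦X⟧} (hg : coeff 0 g = 0) (n : ℕ) {x : PadicAlgCl p} (hx : ‖x‖ < 1) :
    ev x (iter g n) = (fun y => ev y g)^[n] x := by
  induction n generalizing x with
  | zero => simp [iter]
  | succ n ih =>
    rw [iter, ev_comp hx _ hg, ih (norm_ev_lt_one hx hg), Function.iterate_succ_apply]

theorem ev_iter_succ {g : ℤ_[p]⟦X⟧} (hg : coeff 0 g = 0) (n : ℕ) {x : PadicAlgCl p}
    (hx : ‖x‖ < 1) : ev x (iter g (n + 1)) = ev (ev x (iter g n)) g := by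
  rw [ev_iter hg _ hx, ev_iter hg _ hx, Function.iterate_succ_apply']

/-! ### Totally ramified extensions -/

section Uniformizer

variable {L : Type*} [NormedField L] {π : L} {N : ℕ} (hπ : ‖π‖ ^ N = (p : ℝ)⁻¹)

include hπ

theorem exponent_ne_zero_of_norm_pow_eq : N ≠ 0 := by
  rintro rfl
  rw [pow_zero] at hπ
  exact (inv_prime_lt_one (p := p)).ne' hπ

theorem norm_pos_of_norm_pow_eq : 0 < ‖π‖ := by
  refine (norm_nonneg π).lt_of_ne fun h => ?_
  have hN := exponent_ne_zero_of_norm_pow_eq hπ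
  rw [← h, zero_pow hN] at hπ
  exact inv_prime_pos.ne hπ

theorem norm_lt_one_of_norm_pow_eq : ‖π‖ < 1 := by
  by_contra! h
  exact (inv_prime_lt_one (p := p)).not_ge (hπ ▸ one_le_pow₀ h)

variable [NormedAlgebra ℚ_[p] L]

theorem eq_of_norm_smul_pow_eq {a b : ℚ_[p]} (ha : a ≠ 0) (hb : b ≠ 0) {i j : ℕ} (hi : i < N)
    (hj : j < N) (h : ‖a • π ^ i‖ = ‖b • π ^ j‖) : i = j := by
  have hp0 : (0 : ℝ) < p := Nat.cast_pos.mpr (Fact.out : p.Prime).pos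
  have hp1 : (1 : ℝ) < p := Nat.one_lt_cast.mpr (Fact.out : p.Prime).one_lt
  have hnorm {c : ℚ_[p]} (hc : c ≠ 0) (k : ℕ) :
      ‖c • π ^ k‖ ^ N = (p : ℝ) ^ (-(c.valuation * N + k) : ℤ) := by
    rw [norm_smul, mul_pow, norm_pow, ← pow_mul, mul_comm k, pow_mul, hπ,
      Padic.norm_eq_zpow_neg_valuation hc, ← zpow_natCast, ← zpow_mul, inv_pow, ← zpow_natCast,
      ← zpow_neg, ← zpow_add₀ hp0.ne']
    ring_nf
  have hexp : -(a.valuation * N + i) = -(b.valuation * N + j) :=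
    zpow_right_injective₀ hp0 hp1.ne' ((hnorm ha i).symm.trans (h ▸ hnorm hb j))
  have hij : (i : ℤ) = j + (b.valuation - a.valuation) * N := by linarith
  have hmod : (i : ℤ) % N = j % N := by rw [hij, Int.add_mul_emod_self_right]
  rw [Int.emod_eq_of_lt (by positivity) (by exact_mod_cast hi),
    Int.emod_eq_of_lt (by positivity) (by exact_mod_cast hj)] at hmod
  exact_mod_cast hmod

variable [IsUltrametricDist L]

theorem norm_smul_pow_le_norm_sum (a : ℕ → ℚ_[p]) {i : ℕ} (hi : i < N) :
    ‖a i • π ^ i‖ ≤ ‖∑ j ∈ Finset.range N, a j • π ^ j‖ := by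
  classical
  by_cases hai : a i = 0
  · simp [hai]
  have hsum : ∑ j ∈ Finset.range N with a j ≠ 0, a j • π ^ j =
      ∑ j ∈ Finset.range N, a j • π ^ j := by
    refine Finset.sum_filter_of_ne fun j _ hj h0 => hj ?_
    rw [h0, zero_smul]
  have hsup := IsUltrametricDist.nnnorm_sum_eq_sup_of_pairwise_ne
    (s := {j ∈ Finset.range N | a j ≠ 0}) (f := fun j => a j • π ^ j) ?_
  · rw [← hsum, ← coe_nnnorm, ← coe_nnnorm, hsup, NNReal.coe_le_coe]
    exact Finset.le_sup (f := fun j => ‖a j • π ^ j‖₊) (by simp [hi, hai])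
  · intro j hj k hk hjk heq
    simp only [Finset.coe_filter, Finset.mem_range, Set.mem_ofPred_eq] at hj hk
    exact hjk (eq_of_norm_smul_pow_eq hπ hj.2 hk.2 hj.1 hk.1 (congrArg NNReal.toReal heq))

theorem eq_zero_of_aeval_eq_zero {r : Polynomial ℚ_[p]} (hr : r.degree < N)
    (h0 : Polynomial.aeval π r = 0) : r = 0 := by
  by_contra hr0
  have hlt : r.natDegree < N := (Polynomial.natDegree_lt_iff_degree_lt hr0).mpr hr
  have hlead := norm_smul_pow_le_norm_sum hπ r.coeff hlt
  rw [← Polynomial.aeval_eq_sum_range' hlt, h0, norm_zero, norm_le_zero_iff, smul_eq_zero] at hlead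
  exact hlead.elim (hr0 <| Polynomial.leadingCoeff_eq_zero.mp ·)
    (pow_ne_zero _ (norm_pos_iff.mp (norm_pos_of_norm_pow_eq hπ)))

theorem minpoly_eq_of_natDegree_eq {Q : Polynomial ℚ_[p]} (hQ : Q.Monic) (hdeg : Q.natDegree = N)
    (h0 : Polynomial.aeval π Q = 0) : Q = minpoly ℚ_[p] π := by
  refine minpoly.unique' _ _ hQ h0 fun r hr => ?_
  rw [or_iff_not_imp_right, not_not]
  refine eq_zero_of_aeval_eq_zero hπ ?_
  rwa [Polynomial.degree_eq_natDegree hQ.ne_zero, hdeg] at hr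

theorem norm_coeff_le_one_of_norm_sum_le_one {a : ℕ → ℚ_[p]}
    (h : ‖∑ j ∈ Finset.range N, a j • π ^ j‖ ≤ 1) {i : ℕ} (hi : i < N) : ‖a i‖ ≤ 1 := by
  have hp0 : (0 : ℝ) < p := Nat.cast_pos.mpr (Fact.out : p.Prime).pos
  have hterm : ‖a i‖ * ‖π‖ ^ i ≤ 1 := by
    rw [← norm_pow, ← norm_smul]
    exact (norm_smul_pow_le_norm_sum hπ a hi).trans h
  have hpow : (p : ℝ)⁻¹ < ‖π‖ ^ i :=
    hπ ▸ pow_lt_pow_right_of_lt_one₀ (norm_pos_of_norm_pow_eq hπ) (norm_lt_one_of_norm_pow_eq hπ) hi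
  have hlt : ‖a i‖ < p := by
    by_contra! hle
    have := mul_lt_mul' hle hpow inv_prime_pos.le (hp0.trans_le hle)
    rw [mul_inv_cancel₀ hp0.ne'] at this
    exact this.not_ge hterm
  simpa using (Padic.norm_le_pow_iff_norm_lt_pow_add_one (a i) 0).mpr (by simpa using hlt)

end Uniformizer

theorem exists_aeval_eq_of_norm_le_one {π : PadicAlgCl p} {N : ℕ} (hπ : ‖π‖ ^ N = (p : ℝ)⁻¹)
    (hdeg : (minpoly ℚ_[p] π).natDegree = N) {x : PadicAlgCl p}
    (hx : x ∈ IntermediateField.adjoin ℚ_[p] {π}) (hx1 : ‖x‖ ≤ 1) :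
    ∃ r : Polynomial ℤ_[p], Polynomial.aeval π r = x := by
  have hint : IsIntegral ℚ_[p] π := Algebra.IsIntegral.isIntegral π
  obtain ⟨r₀, hr₀⟩ : ∃ r : Polynomial ℚ_[p], Polynomial.aeval π r = x := by
    rw [← IntermediateField.mem_toSubalgebra,
      IntermediateField.adjoin_simple_toSubalgebra_of_isAlgebraic hint.isAlgebraic,
      Algebra.adjoin_singleton_eq_range_aeval] at hx
    exact hx
  let r := r₀ %ₘ minpoly ℚ_[p] π
  have hlt : r.natDegree < N :=
    hdeg ▸ Polynomial.natDegree_modByMonic_lt _ (minpoly.monic hint) (minpoly.ne_one _ _)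
  have hsum : ∑ i ∈ Finset.range N, r.coeff i • π ^ i = x := by
    rw [← Polynomial.aeval_eq_sum_range' hlt, ← hr₀]
    exact Polynomial.aeval_modByMonic_eq_self_of_root (minpoly.aeval _ _)
  have hcoeff (i : Fin N) : ‖r.coeff i‖ ≤ 1 :=
    norm_coeff_le_one_of_norm_sum_le_one hπ (hsum ▸ hx1) i.2
  refine ⟨∑ i : Fin N, Polynomial.monomial (i : ℕ) (⟨r.coeff i, hcoeff i⟩ : ℤ_[p]), ?_⟩
  rw [map_sum, ← hsum, Finset.sum_range]
  exact Finset.sum_congr rfl fun i _ =>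
    (Polynomial.aeval_monomial π).trans (Algebra.smul_def _ _).symm

/-! ### Eisenstein polynomials -/

/-- Monic Eisenstein polynomials over `ℤ_p`: distinguished, with constant coefficient of valuation
one. The latter excludes the constant polynomial `1`. -/
structure IsEisenstein (Q : Polynomial ℤ_[p]) : Prop
    extends Q.IsDistinguishedAt (IsLocalRing.maximalIdeal ℤ_[p]) where
  norm_coeff_zero : ‖Q.coeff 0‖ = (p : ℝ)⁻¹

theorem exists_isEisenstein_mul {g : ℤ_[p]⟦X⟧} {N : ℕ} (hN : wideg g = N)
    (h0 : ‖coeff 0 g‖ = (p : ℝ)⁻¹) :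
    ∃ (Q : Polynomial ℤ_[p]) (h : ℤ_[p]⟦X⟧),
      IsEisenstein Q ∧ Q.natDegree = N ∧ IsUnit h ∧ g = Q * h := by
  have hord : (g.map (IsLocalRing.residue ℤ_[p])).order = N := (order_map_residue g).trans hN
  have hne : g.map (IsLocalRing.residue ℤ_[p]) ≠ 0 :=
    order_eq_top.not.mp (hord ▸ ENat.natCast_ne_top N)
  obtain ⟨Q, h, H⟩ := exists_isWeierstrassFactorization hne
  refine ⟨Q, h, ⟨H.isDistinguishedAt, ?_⟩, ?_, H.isUnit, H.eq_mul⟩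
  · rwa [H.eq_mul, coeff_zero_eq_constantCoeff_apply, map_mul, norm_mul,
      PadicInt.isUnit_iff.mp (isUnit_iff_constantCoeff.mp H.isUnit), mul_one,
      ← coeff_zero_eq_constantCoeff_apply, Polynomial.coeff_coe] at h0
  · rw [H.natDegree_eq_toNat_order_map, hord, ENat.toNat_natCast]

theorem norm_aeval_le_one {x : PadicAlgCl p} (hx : ‖x‖ ≤ 1) (r : Polynomial ℤ_[p]) :
    ‖Polynomial.aeval x r‖ ≤ 1 := by
  rw [Polynomial.aeval_eq_sum_range]
  refine IsUltrametricDist.norm_sum_le_of_forall_le_of_nonneg zero_le_one fun i _ => ?_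
  rw [Algebra.smul_def, norm_mul, norm_pow]
  exact mul_le_one₀ (norm_algebraMap_le_one _) (by positivity) (pow_le_one₀ (norm_nonneg _) hx)

theorem norm_le_one_of_aeval_eq_zero {Q : Polynomial ℤ_[p]} (hQ : Q.Monic) {x : PadicAlgCl p}
    (hx : Polynomial.aeval x Q = 0) : ‖x‖ ≤ 1 := by
  have hroot : Polynomial.aeval x (Q.map (algebraMap ℤ_[p] ℚ_[p])) = 0 := by
    rwa [Polynomial.aeval_map_algebraMap]
  refine (norm_root_le_spectralValue (f := spectralAlgNorm ℚ_[p] (PadicAlgCl p))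
    isPowMul_spectralNorm isNonarchimedean_spectralNorm (hQ.map _) hroot).trans ?_
  rw [spectralValue_le_one_iff (hQ.map _)]
  intro n
  rw [Polynomial.coeff_map]
  exact (Q.coeff n).2

namespace IsEisenstein

variable {Q : Polynomial ℤ_[p]} (hQ : IsEisenstein Q)

include hQ

theorem natDegree_ne_zero : Q.natDegree ≠ 0 := fun h => by
  have hQ0 := hQ.norm_coeff_zero
  rw [Polynomial.eq_one_of_monic_natDegree_zero hQ.monic h, Polynomial.coeff_one_zero,
    norm_one] at hQ0
  exact inv_prime_lt_one.ne' hQ0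

theorem exists_aeval_eq_pow_add :
    ∃ R : Polynomial ℤ_[p], IsUnit (R : ℤ_[p]⟦X⟧) ∧ ∀ x : PadicAlgCl p,
      Polynomial.aeval x Q = x ^ Q.natDegree + p * Polynomial.aeval x R := by
  obtain ⟨R, hR⟩ : Polynomial.C (p : ℤ_[p]) ∣ Q - Polynomial.X ^ Q.natDegree := by
    rw [Polynomial.C_dvd_iff_dvd_coeff]
    intro i
    rw [← Ideal.mem_span_singleton, ← PadicInt.maximalIdeal_eq_span_p,
      ← Ideal.Quotient.eq_zero_iff_mem, ← Polynomial.coeff_map, Polynomial.map_sub,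
      hQ.map_eq_X_pow, Polynomial.map_pow, Polynomial.map_X, sub_self, Polynomial.coeff_zero]
  refine ⟨R, ?_, fun x => by simpa [sub_eq_iff_eq_add'] using congrArg (Polynomial.aeval x) hR⟩
  have h0 := hQ.norm_coeff_zero
  rw [eq_add_of_sub_eq' hR, Polynomial.coeff_add, Polynomial.coeff_X_pow,
    if_neg hQ.natDegree_ne_zero.symm, zero_add, Polynomial.coeff_C_mul, norm_mul,
    PadicInt.norm_p, mul_eq_left₀ inv_prime_pos.ne'] at h0
  rw [isUnit_iff_constantCoeff, ← coeff_zero_eq_constantCoeff_apply, Polynomial.coeff_coe]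
  exact PadicInt.isUnit_iff.mpr h0

theorem norm_lt_one {x : PadicAlgCl p} (hx : Polynomial.aeval x Q = 0) : ‖x‖ < 1 := by
  obtain ⟨R, -, hR⟩ := hQ.exists_aeval_eq_pow_add
  have hpow : x ^ Q.natDegree = -(p * Polynomial.aeval x R) := by
    rwa [hR, add_eq_zero_iff_eq_neg] at hx
  by_contra! hle
  have hle' := one_le_pow₀ hle (n := Q.natDegree)
  rw [← norm_pow, hpow, norm_neg, norm_mul, norm_natCast_prime] at hle'
  refine hle'.not_gt ((mul_le_of_le_one_right inv_prime_pos.le ?_).trans_lt inv_prime_lt_one)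
  exact norm_aeval_le_one (norm_le_one_of_aeval_eq_zero hQ.monic hx) R

theorem norm_pow_natDegree {x : PadicAlgCl p} (hx : Polynomial.aeval x Q = 0) :
    ‖x‖ ^ Q.natDegree = (p : ℝ)⁻¹ := by
  have hx1 := hQ.norm_lt_one hx
  obtain ⟨R, hRu, hR⟩ := hQ.exists_aeval_eq_pow_add
  have hpow : x ^ Q.natDegree = -(p * ev x R) := by
    rwa [hR, add_eq_zero_iff_eq_neg, ← ev_coe] at hx
  rw [← norm_pow, hpow, norm_neg, norm_mul, norm_natCast_prime, norm_ev_eq_one hx1 hRu, mul_one]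

theorem norm_aeval {x : PadicAlgCl p} (hx : ‖x‖ < 1) (h : (p : ℝ)⁻¹ < ‖x‖ ^ Q.natDegree) :
    ‖Polynomial.aeval x Q‖ = ‖x‖ ^ Q.natDegree := by
  obtain ⟨R, -, hR⟩ := hQ.exists_aeval_eq_pow_add
  rw [← norm_pow] at h ⊢
  refine norm_eq_of_norm_sub_lt (lt_of_le_of_lt ?_ h)
  rw [hR, add_sub_cancel_left, norm_mul, norm_natCast_prime]
  exact mul_le_of_le_one_right inv_prime_pos.le (norm_aeval_le_one hx.le R)

theorem minpoly_eq {x : PadicAlgCl p} (hx : Polynomial.aeval x Q = 0) :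
    minpoly ℚ_[p] x = Q.map (algebraMap ℤ_[p] ℚ_[p]) := by
  refine (minpoly_eq_of_natDegree_eq (hQ.norm_pow_natDegree hx) (hQ.monic.map _)
    (hQ.monic.natDegree_map _) ?_).symm
  rwa [Polynomial.aeval_map_algebraMap]

theorem exists_root : ∃ x : PadicAlgCl p, Polynomial.aeval x Q = 0 := by
  obtain ⟨x, hx⟩ := IsAlgClosed.exists_aeval_eq_zero (PadicAlgCl p)
    (Q.map (algebraMap ℤ_[p] ℚ_[p])) (by
      rw [hQ.monic.degree_map, Polynomial.degree_eq_natDegree hQ.monic.ne_zero]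
      exact_mod_cast hQ.natDegree_ne_zero)
  exact ⟨x, by rwa [Polynomial.aeval_map_algebraMap] at hx⟩

/-- Here `x ^ N = -p * R x` with `N` prime to `p` and `‖R x - R y‖ ≤ ‖x - y‖`, whereas
`‖x ^ N - y ^ N‖ = ‖x - y‖ * ‖y‖ ^ (N - 1)`. -/
theorem eq_of_norm_sub_lt (hN : ‖(Q.natDegree : PadicAlgCl p)‖ = 1) {x y : PadicAlgCl p}
    (hx : Polynomial.aeval x Q = 0) (hy : Polynomial.aeval y Q = 0) (h : ‖x - y‖ < ‖y‖) :
    x = y := by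
  have hx1 := hQ.norm_lt_one hx
  have hy1 := hQ.norm_lt_one hy
  have hypow := hQ.norm_pow_natDegree hy
  have hdiff : ‖x ^ Q.natDegree - y ^ Q.natDegree‖ ≤ (p : ℝ)⁻¹ * ‖x - y‖ := by
    obtain ⟨R, -, hR⟩ := hQ.exists_aeval_eq_pow_add
    have heq : x ^ Q.natDegree - y ^ Q.natDegree = -(p * (ev x R - ev y R)) := by
      rw [hR, ← ev_coe] at hx hy
      linear_combination hx - hy
    rw [heq, norm_neg, norm_mul, norm_natCast_prime]
    exact mul_le_mul_of_nonneg_left (norm_ev_sub_ev_le hx1 hy1 _) inv_prime_pos.le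
  rw [norm_pow_sub_pow h hN, mul_comm] at hdiff
  by_contra hne
  refine (le_of_mul_le_mul_right hdiff (norm_sub_pos_iff.mpr hne)).not_gt ?_
  rw [← hypow]
  exact pow_lt_pow_right_of_lt_one₀ (norm_pos_of_norm_pow_eq hypow) hy1
    (Nat.sub_one_lt hQ.natDegree_ne_zero)

theorem dvd_of_ev_eq_zero {x : PadicAlgCl p} (hx : Polynomial.aeval x Q = 0) {g : ℤ_[p]⟦X⟧}
    (hg : ev x g = 0) : (Q : ℤ_[p]⟦X⟧) ∣ g := by
  have hx1 := hQ.norm_lt_one hx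
  have hdiv := hQ.isWeierstrassDivisorAt'.isWeierstrassDivisionAt_div_mod g
  set q := hQ.isWeierstrassDivisorAt'.div g
  set r := hQ.isWeierstrassDivisorAt'.mod g
  have hdeg : r.degree < Q.natDegree := by
    have := hdiv.degree_lt
    rwa [← hQ.coe_natDegree_eq_order_map (Q : ℤ_[p]⟦X⟧) 1 (by simp) (mul_one _).symm,
      ENat.toNat_natCast] at this
  have hr : Polynomial.aeval x r = 0 := by
    rwa [hdiv.eq_mul_add, ev_add hx1, ev_mul hx1, ev_coe, hx, zero_mul, zero_add, ev_coe] at hg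
  have hr0 : r = 0 := by
    have hr' : r.map (algebraMap ℤ_[p] ℚ_[p]) = 0 :=
      eq_zero_of_aeval_eq_zero (hQ.norm_pow_natDegree hx)
        (Polynomial.degree_map_le.trans_lt hdeg) (by rwa [Polynomial.aeval_map_algebraMap])
    exact (Polynomial.map_eq_zero_iff (FaithfulSMul.algebraMap_injective ℤ_[p] ℚ_[p])).mp hr'
  refine ⟨q, ?_⟩
  rw [hdiv.eq_mul_add, hr0, Polynomial.coe_zero, add_zero]

end IsEisenstein

/-! ### The tower of roots of the iterates -/

/-- The roots of `f^{∘ (n+1)}` in the open unit disc which are not roots of `f^{∘ n}`. -/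
def Prim (f : ℤ_[p]⟦X⟧) (n : ℕ) : Set (PadicAlgCl p) :=
  {x | ‖x‖ < 1 ∧ ev x (iter f n) ≠ 0 ∧ ev x (iter f (n + 1)) = 0}

section Prim

variable {f : ℤ_[p]⟦X⟧} {n : ℕ} {x : PadicAlgCl p}

theorem galois_mem_prim (σ : Gal(PadicAlgCl p/ℚ_[p])) (hx : x ∈ Prim f n) : σ x ∈ Prim f n := by
  obtain ⟨hx1, hne, h0⟩ := hx
  refine ⟨by rwa [norm_galois], ?_, ?_⟩
  · rwa [← galois_ev σ hx1, Ne, map_eq_zero_iff σ σ.injective]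
  · rw [← galois_ev σ hx1, h0, map_zero]

variable (hf : coeff 0 f = 0)

include hf

theorem ev_mem_prim (hx : x ∈ Prim f (n + 1)) : ev x f ∈ Prim f n := by
  obtain ⟨hx1, hne, h0⟩ := hx
  exact ⟨norm_ev_lt_one hx1 hf, ev_comp hx1 (iter f n) hf ▸ hne,
    ev_comp hx1 (iter f (n + 1)) hf ▸ h0⟩

theorem ev_iter_eq_zero_of_le (hx : ‖x‖ < 1) {m : ℕ} (hmn : m ≤ n) (h : ev x (iter f m) = 0) :
    ev x (iter f n) = 0 := by
  induction n, hmn using Nat.le_induction with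
  | base => exact h
  | succ k _ ih => rw [ev_iter_succ hf _ hx, ih, ev_zero_left, hf, map_zero]

theorem eq_of_mem_prim {m : ℕ} (hm : x ∈ Prim f m) (hn : x ∈ Prim f n) : m = n :=
  le_antisymm (not_lt.mp fun h => hm.2.1 (ev_iter_eq_zero_of_le hf hn.1 h hn.2.2))
    (not_lt.mp fun h => hn.2.1 (ev_iter_eq_zero_of_le hf hm.1 h hm.2.2))

end Prim

/-- Series `f` without constant term, of Weierstrass degree `p` and with `v_p(f'(0)) = 1`. -/
structure IsHeightOne (f : ℤ_[p]⟦X⟧) : Prop where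
  coeff_zero : coeff 0 f = 0
  wideg_eq : wideg f = p
  norm_coeff_one : ‖coeff 1 f‖ = (p : ℝ)⁻¹

/-- Eisenstein polynomials of degree `p ^ n * (p - 1)` whose roots are the elements of
`Prim f n`. -/
structure IsLevelPoly (f : ℤ_[p]⟦X⟧) (n : ℕ) (Q : Polynomial ℤ_[p]) : Prop
    extends IsEisenstein Q where
  natDegree_eq : Q.natDegree = p ^ n * (p - 1)
  aeval_eq_zero_iff : ∀ x : PadicAlgCl p, Polynomial.aeval x Q = 0 ↔ x ∈ Prim f n

namespace IsHeightOne

variable {f : ℤ_[p]⟦X⟧} (hf : IsHeightOne f)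

include hf

theorem exists_isLevelPoly (n : ℕ) : ∃ Q, IsLevelPoly f n Q := by
  have hf0 := hf.coeff_zero
  have hF0 := coeff_zero_iter hf0 n
  obtain ⟨g, rfl⟩ := X_dvd_iff.mpr (by simpa using hf0)
  have hg0 : ‖coeff 0 g‖ = (p : ℝ)⁻¹ := by
    rw [← coeff_succ_X_mul]
    exact hf.norm_coeff_one
  have hwideg : wideg (comp g (iter (X * g) n)) = (p ^ n * (p - 1) : ℕ) := by
    have hg : 1 + wideg g = 1 + (p - 1 : ℕ) := by
      rw [← wideg_X_mul, hf.wideg_eq, ← Nat.cast_one, ← Nat.cast_add,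
        Nat.add_sub_cancel' (Fact.out : p.Prime).one_le]
    rw [wideg_comp hF0, wideg_iter hf0, hf.wideg_eq,
      ENat.add_right_injective_of_ne_top ENat.one_ne_top hg]
    push_cast
    ring
  obtain ⟨Q, h, hQ, hdeg, hh, heq⟩ := exists_isEisenstein_mul hwideg (by rwa [coeff_zero_comp hF0])
  have hroot {x : PadicAlgCl p} (hx : ‖x‖ < 1) :
      Polynomial.aeval x Q = 0 ↔ ev (ev x (iter (X * g) n)) g = 0 := by
    rw [← ev_comp hx _ hF0, heq, ev_mul hx, ev_coe, mul_eq_zero, or_iff_left]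
    exact norm_ne_zero_iff.mp (by simp [norm_ev_eq_one hx hh])
  have hprim {x : PadicAlgCl p} (hx : ‖x‖ < 1) :
      x ∈ Prim (X * g) n ↔ ev (ev x (iter (X * g) n)) g = 0 := by
    have hy := norm_ev_lt_one hx hF0
    have hg_ne : ev 0 g ≠ 0 := by
      rw [ev_zero_left, ← norm_ne_zero_iff, norm_algebraMap_padicInt, hg0]
      exact inv_prime_pos.ne'
    simp only [Prim, Set.mem_ofPred_eq, hx, true_and, ev_iter_succ hf0 n hx, ev_mul hy, ev_X,
      mul_eq_zero]
    refine ⟨fun h => h.2.resolve_left h.1, fun h => ⟨fun h0 => hg_ne ?_, Or.inr h⟩⟩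
    rwa [h0] at h
  exact ⟨Q, hQ, hdeg, fun x => ⟨fun hx => (hprim (hQ.norm_lt_one hx)).mpr
    ((hroot (hQ.norm_lt_one hx)).mp hx), fun hx => (hroot hx.1).mpr ((hprim hx.1).mp hx)⟩⟩

theorem norm_pow_of_mem_prim {n : ℕ} {x : PadicAlgCl p} (hx : x ∈ Prim f n) :
    ‖x‖ ^ (p ^ n * (p - 1)) = (p : ℝ)⁻¹ := by
  obtain ⟨Q, hQ⟩ := hf.exists_isLevelPoly n
  rw [← hQ.natDegree_eq]
  exact hQ.norm_pow_natDegree ((hQ.aeval_eq_zero_iff x).mpr hx)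

theorem norm_pos_of_mem_prim {n : ℕ} {x : PadicAlgCl p} (hx : x ∈ Prim f n) : 0 < ‖x‖ :=
  norm_pos_of_norm_pow_eq (hf.norm_pow_of_mem_prim hx)

theorem ne_zero_of_mem_prim {n : ℕ} {x : PadicAlgCl p} (hx : x ∈ Prim f n) : x ≠ 0 :=
  norm_pos_iff.mp (hf.norm_pos_of_mem_prim hx)

theorem natDegree_minpoly {n : ℕ} {x : PadicAlgCl p} (hx : x ∈ Prim f n) :
    (minpoly ℚ_[p] x).natDegree = p ^ n * (p - 1) := by
  obtain ⟨Q, hQ⟩ := hf.exists_isLevelPoly n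
  rw [hQ.minpoly_eq ((hQ.aeval_eq_zero_iff x).mpr hx), hQ.monic.natDegree_map, hQ.natDegree_eq]

theorem finrank_adjoin {n : ℕ} {x : PadicAlgCl p} (hx : x ∈ Prim f n) :
    Module.finrank ℚ_[p] (IntermediateField.adjoin ℚ_[p] {x}) = p ^ n * (p - 1) := by
  rw [IntermediateField.adjoin.finrank (Algebra.IsIntegral.isIntegral x), hf.natDegree_minpoly hx]

theorem exists_galois_eq {n : ℕ} {x y : PadicAlgCl p} (hx : x ∈ Prim f n) (hy : y ∈ Prim f n) :
    ∃ σ : Gal(PadicAlgCl p/ℚ_[p]), σ x = y := by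
  obtain ⟨Q, hQ⟩ := hf.exists_isLevelPoly n
  rw [← isConjRoot_iff_exists_algEquiv, IsConjRoot,
    hQ.minpoly_eq ((hQ.aeval_eq_zero_iff x).mpr hx),
    hQ.minpoly_eq ((hQ.aeval_eq_zero_iff y).mpr hy)]

theorem prim_nonempty (n : ℕ) : (Prim f n).Nonempty := by
  obtain ⟨Q, hQ⟩ := hf.exists_isLevelPoly n
  obtain ⟨x, hx⟩ := hQ.exists_root
  exact ⟨x, (hQ.aeval_eq_zero_iff x).mp hx⟩

theorem exists_mem_prim_succ_ev_eq {n : ℕ} {x : PadicAlgCl p} (hx : x ∈ Prim f n) :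
    ∃ y ∈ Prim f (n + 1), ev y f = x := by
  obtain ⟨z, hz⟩ := hf.prim_nonempty (n + 1)
  obtain ⟨σ, hσ⟩ := hf.exists_galois_eq (ev_mem_prim hf.coeff_zero hz) hx
  exact ⟨σ z, galois_mem_prim σ hz, by rw [← galois_ev σ hz.1, hσ]⟩

theorem eq_of_mem_prim_zero {x y : PadicAlgCl p} (hx : x ∈ Prim f 0) (hy : y ∈ Prim f 0)
    (h : ‖x - y‖ < ‖y‖) : x = y := by
  obtain ⟨Q, hQ⟩ := hf.exists_isLevelPoly 0
  refine hQ.eq_of_norm_sub_lt ?_ ((hQ.aeval_eq_zero_iff x).mpr hx)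
    ((hQ.aeval_eq_zero_iff y).mpr hy) h
  rw [hQ.natDegree_eq, pow_zero, one_mul]
  exact norm_natCast_eq_one coprime_prime_sub_one

theorem pow_dvd_coeff_zero (m : ℕ) (g : ℤ_[p]⟦X⟧) (hg : ∀ k < m, ∀ x ∈ Prim f k, ev x g = 0) :
    (p : ℤ_[p]) ^ m ∣ coeff 0 g := by
  induction m generalizing g with
  | zero => simp
  | succ m ih =>
    obtain ⟨Q, hQ⟩ := hf.exists_isLevelPoly m
    obtain ⟨x, hx⟩ := hf.prim_nonempty m
    obtain ⟨q, rfl⟩ := hQ.dvd_of_ev_eq_zero ((hQ.aeval_eq_zero_iff x).mpr hx)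
      (hg m (Nat.lt_succ_self m) x hx)
    have hq : (p : ℤ_[p]) ^ m ∣ coeff 0 q := by
      refine ih q fun k hk y hy => ?_
      have h0 := hg k (hk.trans (Nat.lt_succ_self m)) y hy
      rw [ev_mul hy.1, ev_coe, mul_eq_zero, hQ.aeval_eq_zero_iff] at h0
      exact h0.resolve_left fun hym => hk.ne (eq_of_mem_prim hf.coeff_zero hy hym)
    have hQ0 : (p : ℤ_[p]) ∣ Q.coeff 0 := by
      rw [← PadicInt.norm_lt_one_iff_dvd, hQ.norm_coeff_zero]
      exact inv_prime_lt_one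
    rw [coeff_zero_mul, Polynomial.coeff_coe, pow_succ']
    exact mul_dvd_mul hQ0 hq

end IsHeightOne

/-! ### Series congruent to the identity which commute with `f` -/

section LinearCoefficient

variable {R : Type*} [CommRing R]

theorem coeff_one_comp {g h : R⟦X⟧} (hg : coeff 0 g = 0) (hh : coeff 0 h = 0) :
    coeff 1 (comp g h) = coeff 1 g * coeff 1 h := by
  obtain ⟨g', rfl⟩ := X_dvd_iff.mpr (by simpa using hg)
  obtain ⟨h', hh'⟩ := X_dvd_iff.mpr (by simpa using hh)
  have hcomp : comp (X * g') h = X * (h' * comp g' h) := by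
    rw [← compHom_apply hh, map_mul, compHom_X, compHom_apply, ← mul_assoc, ← hh']
  rw [hcomp, coeff_succ_X_mul, coeff_succ_X_mul, hh', coeff_succ_X_mul, ← hh',
    coeff_zero_mul, coeff_zero_comp hh, mul_comm]

theorem coeff_one_iter {g : R⟦X⟧} (hg : coeff 0 g = 0) (n : ℕ) :
    coeff 1 (iter g n) = coeff 1 g ^ n := by
  induction n with
  | zero => rw [iter, coeff_one_X, pow_zero]
  | succ n ih => rw [iter, coeff_one_comp (coeff_zero_iter hg n) hg, ih, pow_succ]

theorem exists_eq_X_add_X_mul {u : R⟦X⟧} (hu : coeff 0 u = 0) :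
    ∃ w, coeff 0 w = coeff 1 u - 1 ∧ u = X + X * w := by
  obtain ⟨v, rfl⟩ := X_dvd_iff.mpr (by simpa using hu)
  refine ⟨v - 1, ?_, by ring⟩
  rw [coeff_succ_X_mul, map_sub, coeff_zero_one]

end LinearCoefficient

theorem norm_ev_sub_self_lt {v : ℤ_[p]⟦X⟧} (h0 : coeff 0 v = 0) (h1 : (p : ℤ_[p]) ∣ coeff 1 v - 1)
    {x : PadicAlgCl p} (hx : ‖x‖ < 1) (hx0 : x ≠ 0) : ‖ev x v - x‖ < ‖x‖ := by
  obtain ⟨w, hw0, rfl⟩ := exists_eq_X_add_X_mul h0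
  have hw : ‖ev x w‖ < 1 := by
    rw [← sub_add_cancel (ev x w)]
    refine norm_add_lt ((norm_ev_sub_coeff_zero_le hx w).trans_lt hx) ?_
    rwa [norm_algebraMap_padicInt, PadicInt.norm_lt_one_iff_dvd, hw0]
  rw [ev_add hx, ev_mul hx, ev_X, add_sub_cancel_left, norm_mul]
  exact mul_lt_of_lt_one_right (norm_pos_iff.mpr hx0) hw

/-- `u(0) = 0`, `u'(0)` is a one-unit, and `u` commutes with `f` as functions on the open unit
disc. -/
structure IsUnitCommuting (f u : ℤ_[p]⟦X⟧) : Prop where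
  coeff_zero : coeff 0 u = 0
  dvd_sub_one : (p : ℤ_[p]) ∣ coeff 1 u - 1
  comm : ∀ x : PadicAlgCl p, ‖x‖ < 1 → ev (ev x f) u = ev (ev x u) f

namespace IsUnitCommuting

variable {f u : ℤ_[p]⟦X⟧} (hu : IsUnitCommuting f u)

include hu

theorem iter_right (hf0 : coeff 0 f = 0) (k : ℕ) : IsUnitCommuting f (iter u k) where
  coeff_zero := coeff_zero_iter hu.coeff_zero k
  dvd_sub_one := by
    rw [coeff_one_iter hu.coeff_zero]
    exact hu.dvd_sub_one.trans (sub_one_dvd_pow_sub_one _ k)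
  comm := by
    induction k with
    | zero => simp [iter]
    | succ k ih =>
      intro x hx
      rw [iter, ev_comp (norm_ev_lt_one hx hf0) _ hu.coeff_zero, hu.comm x hx,
        ih _ (norm_ev_lt_one hx hu.coeff_zero), ev_comp hx _ hu.coeff_zero]

theorem comm_iter_left (hf0 : coeff 0 f = 0) (n : ℕ) {x : PadicAlgCl p} (hx : ‖x‖ < 1) :
    ev (ev x (iter f n)) u = ev (ev x u) (iter f n) := by
  induction n generalizing x with
  | zero => simp [iter]
  | succ n ih =>
    rw [iter, ev_comp hx _ hf0, ih (norm_ev_lt_one hx hf0), hu.comm x hx,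
      ev_comp (norm_ev_lt_one hx hu.coeff_zero) _ hf0]

theorem ev_mem_prim (hf0 : coeff 0 f = 0) {n : ℕ} {x : PadicAlgCl p} (hx : x ∈ Prim f n) :
    ev x u ∈ Prim f n := by
  obtain ⟨hx1, hne, h0⟩ := hx
  refine ⟨norm_ev_lt_one hx1 hu.coeff_zero, ?_, ?_⟩
  · rw [← hu.comm_iter_left hf0 n hx1, ← norm_ne_zero_iff,
      norm_eq_of_norm_sub_lt (norm_ev_sub_self_lt hu.coeff_zero hu.dvd_sub_one
        (norm_ev_lt_one hx1 (coeff_zero_iter hf0 n)) hne)]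
    exact norm_ne_zero_iff.mpr hne
  · rw [← hu.comm_iter_left hf0 _ hx1, h0, ev_zero_left, hu.coeff_zero, map_zero]

variable (hf : IsHeightOne f)

include hf

theorem ev_eq_self {x : PadicAlgCl p} (hx : x ∈ Prim f 0) : ev x u = x :=
  hf.eq_of_mem_prim_zero (hu.ev_mem_prim hf.coeff_zero hx) hx
    (norm_ev_sub_self_lt hu.coeff_zero hu.dvd_sub_one hx.1 (hf.ne_zero_of_mem_prim hx))

theorem ev_eq_self_of_le {m n : ℕ} (hmn : m ≤ n) {x y : PadicAlgCl p} (hx : x ∈ Prim f n)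
    (hy : y ∈ Prim f m) (h : ev x u = x) : ev y u = y := by
  induction n generalizing x with
  | zero =>
    obtain rfl := Nat.le_zero.mp hmn
    exact hu.ev_eq_self hf hy
  | succ n ih =>
    rcases hmn.eq_or_lt with rfl | hlt
    · obtain ⟨σ, rfl⟩ := hf.exists_galois_eq hx hy
      rw [← galois_ev σ hx.1, h]
    · exact ih (Nat.lt_succ_iff.mp hlt) (CommutingPair.ev_mem_prim hf.coeff_zero hx)
        (by rw [hu.comm x hx.1, h])

theorem pow_dvd_coeff_one_sub_one {n : ℕ} {x : PadicAlgCl p} (hx : x ∈ Prim f n)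
    (h : ev x u = x) : (p : ℤ_[p]) ^ (n + 1) ∣ coeff 1 u - 1 := by
  obtain ⟨w, hw0, hw⟩ := exists_eq_X_add_X_mul hu.coeff_zero
  rw [← hw0]
  refine hf.pow_dvd_coeff_zero (n + 1) w fun k hk y hy => ?_
  have hy0 := hu.ev_eq_self_of_le hf (Nat.lt_succ_iff.mp hk) hx hy h
  rw [hw, ev_add hy.1, ev_mul hy.1, ev_X, add_eq_left, mul_eq_zero] at hy0
  exact hy0.resolve_left (hf.ne_zero_of_mem_prim hy)

/-- The level polynomial `Q` of `Prim f 0` divides `w = (u - x) / x`, since `u` fixes the roots of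
`Q`; the quotient is a unit because `w(0) = u'(0) - 1`. -/
theorem norm_ev_sub_self (h1 : ‖coeff 1 u - 1‖ = (p : ℝ)⁻¹) {n : ℕ} {x : PadicAlgCl p}
    (hx : x ∈ Prim f (n + 1)) : ‖ev x u - x‖ = ‖x‖ ^ p := by
  have hp := (Fact.out : p.Prime).two_le
  obtain ⟨Q, hQ⟩ := hf.exists_isLevelPoly 0
  obtain ⟨y, hy⟩ := hf.prim_nonempty 0
  obtain ⟨w, hw0, hw⟩ := exists_eq_X_add_X_mul hu.coeff_zero
  have hyw : ev y w = 0 := by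
    have hy0 := hu.ev_eq_self hf hy
    rw [hw, ev_add hy.1, ev_mul hy.1, ev_X, add_eq_left, mul_eq_zero] at hy0
    exact hy0.resolve_left (hf.ne_zero_of_mem_prim hy)
  obtain ⟨q, rfl⟩ := hQ.dvd_of_ev_eq_zero ((hQ.aeval_eq_zero_iff y).mpr hy) hyw
  have hq : IsUnit q := by
    rw [← hw0, coeff_zero_mul, Polynomial.coeff_coe, norm_mul, hQ.norm_coeff_zero,
      mul_eq_left₀ inv_prime_pos.ne'] at h1
    rw [isUnit_iff_constantCoeff, ← coeff_zero_eq_constantCoeff_apply]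
    exact PadicInt.isUnit_iff.mpr h1
  have hlt : (p : ℝ)⁻¹ < ‖x‖ ^ Q.natDegree := by
    rw [← hf.norm_pow_of_mem_prim hx, hQ.natDegree_eq]
    refine pow_lt_pow_right_of_lt_one₀ (hf.norm_pos_of_mem_prim hx) hx.1 ?_
    exact Nat.mul_lt_mul_of_pos_right (Nat.pow_lt_pow_right hp n.succ_pos) (by omega)
  rw [hw, ev_add hx.1, ev_mul hx.1, ev_X, add_sub_cancel_left, ev_mul hx.1, ev_coe, norm_mul,
    norm_mul, hQ.norm_aeval hx.1 hlt, norm_ev_eq_one hx.1 hq, mul_one, ← pow_succ',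
    hQ.natDegree_eq, pow_zero, one_mul, Nat.sub_add_cancel (by omega)]

end IsUnitCommuting

/-! ### Residues in the prime field -/

theorem toZMod_eq_toZMod_iff {a b : ℤ_[p]} :
    PadicInt.toZMod a = PadicInt.toZMod b ↔ ‖a - b‖ < 1 := by
  rw [← sub_eq_zero, ← map_sub, ← RingHom.mem_ker, PadicInt.ker_toZMod,
    IsLocalRing.mem_maximalIdeal, PadicInt.mem_nonunits]

/-- The integral element `s` reduces to `a` in the residue field. Only residues in the prime field
are considered, so that they can be read off from elements of `ℤ_p`. -/
def HasResidue (s : PadicAlgCl p) (a : ZMod p) : Prop :=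
  ∃ c : ℤ_[p], PadicInt.toZMod c = a ∧ ‖s - algebraMap ℤ_[p] (PadicAlgCl p) c‖ < 1

theorem hasResidue_algebraMap (c : ℤ_[p]) :
    HasResidue (algebraMap ℤ_[p] (PadicAlgCl p) c) (PadicInt.toZMod c) :=
  ⟨c, rfl, by simp⟩

namespace HasResidue

variable {s t : PadicAlgCl p} {a b : ZMod p}

theorem norm_sub_lt_one (hs : HasResidue s a) (ht : HasResidue t a) : ‖s - t‖ < 1 := by
  obtain ⟨c, hc, hsc⟩ := hs
  obtain ⟨d, hd, htd⟩ := ht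
  have hcd := toZMod_eq_toZMod_iff.mp (hc.trans hd.symm)
  rw [← norm_algebraMap_padicInt, map_sub] at hcd
  have h := norm_sub_lt (norm_add_lt hsc hcd) htd
  rwa [sub_add_sub_cancel, sub_sub_sub_cancel_right] at h

theorem unique (ha : HasResidue s a) (hb : HasResidue s b) : a = b := by
  obtain ⟨c, rfl, hc⟩ := ha
  obtain ⟨d, rfl, hd⟩ := hb
  rw [toZMod_eq_toZMod_iff, ← norm_algebraMap_padicInt, map_sub]
  simpa only [sub_sub_sub_cancel_left] using norm_sub_lt hd hc

theorem norm_le_one (hs : HasResidue s a) : ‖s‖ ≤ 1 := by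
  obtain ⟨c, -, hc⟩ := hs
  rw [← sub_add_cancel s (algebraMap ℤ_[p] (PadicAlgCl p) c)]
  exact (IsUltrametricDist.norm_add_le_max _ _).trans (max_le hc.le (norm_algebraMap_le_one c))

theorem mul (hs : HasResidue s a) (ht : HasResidue t b) : HasResidue (s * t) (a * b) := by
  have ht1 := ht.norm_le_one
  obtain ⟨c, rfl, hc⟩ := hs
  obtain ⟨d, rfl, hd⟩ := ht
  refine ⟨c * d, map_mul _ _ _, ?_⟩
  rw [map_mul, ← sub_add_sub_cancel _ (algebraMap ℤ_[p] (PadicAlgCl p) c * t), ← sub_mul,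
    ← mul_sub]
  refine norm_add_lt ?_ ?_ <;> rw [norm_mul]
  · exact mul_lt_one_of_nonneg_of_lt_one_left (norm_nonneg _) hc ht1
  · exact mul_lt_one_of_nonneg_of_lt_one_right (norm_algebraMap_le_one c) (norm_nonneg _) hd

theorem pow (hs : HasResidue s a) (n : ℕ) : HasResidue (s ^ n) (a ^ n) := by
  induction n with
  | zero => simpa only [pow_zero, map_one] using hasResidue_algebraMap (1 : ℤ_[p])
  | succ n ih => simpa only [pow_succ] using ih.mul hs

theorem galois (hs : HasResidue s a) (σ : Gal(PadicAlgCl p/ℚ_[p])) : HasResidue (σ s) a := by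
  obtain ⟨c, rfl, hc⟩ := hs
  have hσ : σ (algebraMap ℤ_[p] (PadicAlgCl p) c) = algebraMap ℤ_[p] (PadicAlgCl p) c :=
    σ.commutes (c : ℚ_[p])
  rw [← norm_galois σ, map_sub, hσ] at hc
  exact ⟨c, rfl, hc⟩

end HasResidue

theorem hasResidue_one_iff {s : PadicAlgCl p} : HasResidue s 1 ↔ ‖s - 1‖ < 1 := by
  refine ⟨fun h => h.norm_sub_lt_one ?_, fun h => ⟨1, map_one _, by rwa [map_one]⟩⟩
  simpa only [map_one] using hasResidue_algebraMap (1 : ℤ_[p])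

theorem HasResidue.norm_pow_sub_one_lt {s : PadicAlgCl p} {a : ZMod p} (h : HasResidue s a)
    (hs : ‖s‖ = 1) : ‖s ^ (p - 1) - 1‖ < 1 := by
  have ha : a ≠ 0 := by
    rintro rfl
    have h0 := h.norm_sub_lt_one (by simpa only [map_zero] using hasResidue_algebraMap (0 : ℤ_[p]))
    exact h0.ne (by rwa [sub_zero])
  rw [← hasResidue_one_iff, ← ZMod.pow_card_sub_one_eq_one ha]
  exact h.pow _

namespace IsHeightOne

variable {f : ℤ_[p]⟦X⟧} (hf : IsHeightOne f) {n : ℕ} {x y : PadicAlgCl p} (hx : x ∈ Prim f n)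
  (hy : y ∈ IntermediateField.adjoin ℚ_[p] {x}) (hy1 : ‖y‖ ≤ 1)

include hf hx hy hy1

theorem exists_ev_eq : ∃ r : ℤ_[p]⟦X⟧, ev x r = y := by
  obtain ⟨r, hr⟩ := exists_aeval_eq_of_norm_le_one (hf.norm_pow_of_mem_prim hx)
    (hf.natDegree_minpoly hx) hy hy1
  exact ⟨r, (ev_coe x r).trans hr⟩

theorem exists_hasResidue : ∃ a, HasResidue y a := by
  obtain ⟨r, rfl⟩ := hf.exists_ev_eq hx hy hy1
  exact ⟨_, coeff 0 r, rfl, (norm_ev_sub_coeff_zero_le hx.1 r).trans_lt hx.1⟩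

theorem norm_galois_sub_le (σ : Gal(PadicAlgCl p/ℚ_[p])) : ‖σ y - y‖ ≤ ‖σ x - x‖ := by
  obtain ⟨r, rfl⟩ := hf.exists_ev_eq hx hy hy1
  rw [galois_ev σ hx.1]
  exact norm_ev_sub_ev_le (by rw [norm_galois]; exact hx.1) hx.1 r

end IsHeightOne

/-! ### Powers of principal units -/

theorem emultiplicity_pow_sub_one {R : Type*} [CommRing R] [IsDomain R] (hpR : Prime (p : R))
    (hodd : Odd p) {a : R} (ha : (p : R) ∣ a - 1) (k : ℕ) :
    emultiplicity (p : R) (a ^ k - 1) = emultiplicity (p : R) (a - 1) + emultiplicity p k := by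
  have hp : p.Prime := Fact.out
  have not_dvd {b : R} (hb : (p : R) ∣ b - 1) : ¬ (p : R) ∣ b := fun h =>
    hpR.not_dvd_one ((dvd_sub_right h).mp hb)
  rcases eq_or_ne k 0 with rfl | hk
  · simp
  obtain ⟨e, m, hm, rfl⟩ := Nat.exists_eq_pow_mul_and_not_dvd hk p hp.ne_one
  have hmR : ¬ (p : R) ∣ m := fun h => hpR.not_isUnit <|
    (((hp.coprime_iff_not_dvd.mpr hm).cast : IsCoprime (p : R) m).isUnit_of_dvd h)
  have hae : (p : R) ∣ a ^ p ^ e - 1 := ha.trans (sub_one_dvd_pow_sub_one a _)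
  have h1 := emultiplicity_pow_sub_pow_of_prime hpR (y := 1) hae (not_dvd hae) hmR
  have h2 := emultiplicity_pow_prime_pow_sub_pow_prime_pow hpR hodd ha (not_dvd ha) e
  rw [one_pow] at h1 h2
  rw [pow_mul, h1, h2, emultiplicity_mul hp.prime, emultiplicity_eq_zero.mpr hm, add_zero,
    hp.emultiplicity_pow_self]

theorem emultiplicity_eq_one_of_norm_eq {a : ℤ_[p]} (ha : ‖a‖ = (p : ℝ)⁻¹) :
    emultiplicity (p : ℤ_[p]) a = 1 := by
  have dvd_iff (n : ℕ) : (p : ℤ_[p]) ^ n ∣ a ↔ (p : ℝ)⁻¹ ≤ (p : ℝ)⁻¹ ^ n := by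
    rw [← Ideal.mem_span_singleton, ← PadicInt.norm_le_pow_iff_mem_span_pow, ha, zpow_neg,
      zpow_natCast, inv_pow]
  refine emultiplicity_eq_coe.mpr ⟨(dvd_iff 1).mpr (pow_one _).ge, fun h => ?_⟩
  exact ((dvd_iff _).mp h).not_gt
    (pow_lt_self_of_lt_one₀ inv_prime_pos inv_prime_lt_one one_lt_two)

theorem pow_dvd_of_pow_succ_dvd_pow_sub_one (hodd : Odd p) {a : ℤ_[p]}
    (ha : ‖a - 1‖ = (p : ℝ)⁻¹) {k n : ℕ} (h : (p : ℤ_[p]) ^ (n + 1) ∣ a ^ k - 1) : p ^ n ∣ k := by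
  have hv := emultiplicity_eq_one_of_norm_eq ha
  have hpa : (p : ℤ_[p]) ∣ a - 1 := by
    rw [← pow_one (p : ℤ_[p]), pow_dvd_iff_le_emultiplicity, hv, Nat.cast_one]
  rw [pow_dvd_iff_le_emultiplicity, emultiplicity_pow_sub_one PadicInt.prime_p hodd hpa, hv,
    Nat.cast_add, Nat.cast_one, add_comm 1] at h
  rw [pow_dvd_iff_le_emultiplicity]
  exact (ENat.add_le_add_iff_right ENat.one_ne_top).mp h

theorem norm_pow_sub_one_of_not_dvd {a : ℤ_[p]} (ha : ‖a - 1‖ < 1) {k : ℕ} (hk : ¬ p ∣ k) :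
    ‖a ^ k - 1‖ = ‖a - 1‖ := by
  have hk1 := norm_natCast_eq_one ((Fact.out : p.Prime).coprime_iff_not_dvd.mpr hk)
  simp only [← norm_algebraMap_padicInt, map_sub, map_pow, map_one] at ha ⊢
  exact norm_pow_sub_one ha hk1

/-! ### Automorphisms acting through a series -/

theorem galois_pow_apply {u : ℤ_[p]⟦X⟧} (hu0 : coeff 0 u = 0) {υ : Gal(PadicAlgCl p/ℚ_[p])}
    {x : PadicAlgCl p} (hx : ‖x‖ < 1) (hυ : υ x = ev x u) (k : ℕ) :
    (υ ^ k) x = ev x (iter u k) := by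
  induction k with
  | zero => simp [iter]
  | succ k ih =>
    rw [pow_succ, AlgEquiv.mul_apply, hυ, galois_ev _ hx, ih, ev_iter_succ hu0 _ hx]

namespace IsUnitCommuting

variable {f u : ℤ_[p]⟦X⟧} (hu : IsUnitCommuting f u) (hf : IsHeightOne f)
  (h1 : ‖coeff 1 u - 1‖ = (p : ℝ)⁻¹)

include hu hf h1

theorem pow_dvd_of_galois_pow_eq (hodd : Odd p) {n : ℕ} {x : PadicAlgCl p} (hx : x ∈ Prim f n)
    {υ : Gal(PadicAlgCl p/ℚ_[p])} (hυ : υ x = ev x u) {k : ℕ} (hk : (υ ^ k) x = x) :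
    p ^ n ∣ k := by
  rw [galois_pow_apply hu.coeff_zero hx.1 hυ] at hk
  have h := (hu.iter_right hf.coeff_zero k).pow_dvd_coeff_one_sub_one hf hx hk
  rw [coeff_one_iter hu.coeff_zero] at h
  exact pow_dvd_of_pow_succ_dvd_pow_sub_one hodd h1 h

variable {n : ℕ} {x : PadicAlgCl p} (hx : x ∈ Prim f (n + 1)) {υ : Gal(PadicAlgCl p/ℚ_[p])}
  (hυ : υ x = ev x u)

include hx hυ

/-- The residue of `(υ y - y) / y ^ p` does not depend on the uniformizer `y` of `ℚ_p(x)`. -/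
theorem norm_galois_sub_sub_mul_pow_lt {y : PadicAlgCl p}
    (hy : y ∈ IntermediateField.adjoin ℚ_[p] {x}) (hyx : ‖y‖ = ‖x‖) :
    ‖υ y - y - (υ x - x) / x ^ p * y ^ p‖ < ‖x‖ ^ p := by
  have hx0 : x ≠ 0 := hf.ne_zero_of_mem_prim hx
  have hδ : ‖υ x - x‖ = ‖x‖ ^ p := hυ ▸ hu.norm_ev_sub_self hf h1 hx
  have hxmem := IntermediateField.mem_adjoin_simple_self ℚ_[p] x
  obtain ⟨t, rfl⟩ : ∃ t, y = t * x := ⟨y / x, (div_mul_cancel₀ y hx0).symm⟩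
  have ht : t ∈ IntermediateField.adjoin ℚ_[p] {x} := by
    simpa only [mul_div_cancel_right₀ t hx0] using div_mem hy hxmem
  have ht1 : ‖t‖ = 1 := by
    rwa [norm_mul, mul_eq_right₀ (norm_ne_zero_iff.mpr hx0)] at hyx
  obtain ⟨a, ha⟩ := hf.exists_hasResidue hx ht ht1.le
  have hps : t ^ p = t ^ (p - 1) * t := by
    rw [← pow_succ, Nat.sub_add_cancel (Fact.out : p.Prime).one_le]
  have key : υ (t * x) - t * x - (υ x - x) / x ^ p * (t * x) ^ p =
      (υ t - t) * υ x - t * (t ^ (p - 1) - 1) * (υ x - x) := by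
    rw [map_mul, mul_pow, mul_left_comm, div_mul_cancel₀ _ (pow_ne_zero p hx0), hps]
    ring
  rw [key]
  refine norm_sub_lt ?_ ?_
  · rw [norm_mul, norm_galois]
    refine (mul_le_mul_of_nonneg_right ?_ (norm_nonneg x)).trans_lt
      (mul_lt_of_lt_one_right (pow_pos (norm_pos_iff.mpr hx0) p) hx.1)
    exact hδ ▸ hf.norm_galois_sub_le hx ht ht1.le υ
  · rw [norm_mul, norm_mul, ht1, one_mul, hδ]
    exact mul_lt_of_lt_one_left (pow_pos (norm_pos_iff.mpr hx0) p) (ha.norm_pow_sub_one_lt ht1)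

variable (hN : ∀ σ : Gal(PadicAlgCl p/ℚ_[p]), σ x ∈ IntermediateField.adjoin ℚ_[p] {x})
  (σ : Gal(PadicAlgCl p/ℚ_[p]))

include hN

theorem norm_conj_sub_lt : ‖(σ * υ * σ⁻¹) x - υ x‖ < ‖x‖ ^ p := by
  have hx0 : x ≠ 0 := hf.ne_zero_of_mem_prim hx
  have hxp : 0 < ‖x‖ ^ p := pow_pos (norm_pos_iff.mpr hx0) p
  have hxmem := IntermediateField.mem_adjoin_simple_self ℚ_[p] x
  set d := (υ x - x) / x ^ p with hd
  have hd1 : ‖d‖ ≤ 1 := by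
    rw [hd, norm_div, norm_pow, hυ, hu.norm_ev_sub_self hf h1 hx, div_self hxp.ne']
  obtain ⟨a, ha⟩ := hf.exists_hasResidue hx
    (div_mem (sub_mem (hN υ) hxmem) (pow_mem hxmem p)) hd1
  have hσx : σ (σ⁻¹ x) = x := by rw [← AlgEquiv.mul_apply, mul_inv_cancel, AlgEquiv.one_apply]
  have key : (σ * υ * σ⁻¹) x - υ x =
      σ (υ (σ⁻¹ x) - σ⁻¹ x - d * (σ⁻¹ x) ^ p) + (σ d - d) * x ^ p := by
    rw [map_sub, map_sub, map_mul, map_pow, hσx, sub_mul, hd, div_mul_cancel₀ _ (pow_ne_zero p hx0)]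
    simp only [AlgEquiv.mul_apply]
    ring
  rw [key]
  refine norm_add_lt ?_ ?_
  · rw [norm_galois]
    exact hu.norm_galois_sub_sub_mul_pow_lt hf h1 hx hυ (hN σ⁻¹) (norm_galois _ _)
  · rw [norm_mul, norm_pow]
    exact mul_lt_of_lt_one_left hxp ((ha.galois σ).norm_sub_lt_one ha)

theorem dvd_of_conj_eq {a : ℕ} (ha : (σ * υ * σ⁻¹) x = (υ ^ (a + 1)) x) : p ∣ a := by
  by_contra hpa
  have hlt := hu.norm_conj_sub_lt hf h1 hx hυ hN σ
  rw [ha, pow_succ', AlgEquiv.mul_apply, ← map_sub, norm_galois,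
    galois_pow_apply hu.coeff_zero hx.1 hυ] at hlt
  refine hlt.ne ((hu.iter_right hf.coeff_zero a).norm_ev_sub_self hf ?_ hx)
  rw [coeff_one_iter hu.coeff_zero, norm_pow_sub_one_of_not_dvd (h1 ▸ inv_prime_lt_one) hpa, h1]

end IsUnitCommuting

/-! ### Compact groups as completions -/

theorem exists_forall_mem_of_antitone {D : Type*} [TopologicalSpace D] [CompactSpace D]
    {S : ℕ → Set D} (hS : Antitone S) (hne : ∀ n, (S n).Nonempty) (hcl : ∀ n, IsClosed (S n)) :
    ∃ d, ∀ n, d ∈ S n := by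
  obtain ⟨d, hd⟩ := IsCompact.nonempty_iInter_of_sequence_nonempty_isCompact_isClosed S
    (fun n => hS n.le_succ) hne (hcl 0).isCompact hcl
  exact ⟨d, Set.mem_iInter.mp hd⟩

section Completion

variable {A G : Type*} [Group A] [TopologicalSpace A] [IsTopologicalGroup A]
  [Group G] [TopologicalSpace G] [IsTopologicalGroup G]

theorem exists_continuousMulEquiv_of_injective_of_dense [T2Space A] {D : Type*} [Group D]
    [TopologicalSpace D] [CompactSpace D] {φ : D →* A} (hφ : Continuous φ)
    (hinj : Function.Injective φ) {U : ℕ → Subgroup A} (hU : ∀ n, IsOpen (U n : Set A))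
    (hanti : Antitone U) (hsep : ∀ a, (∀ n, a ∈ U n) → a = 1)
    (hdense : ∀ n a, ∃ d, (φ d)⁻¹ * a ∈ U n) : ∃ e : D ≃ₜ* A, ∀ d, e d = φ d := by
  have hsurj : Function.Surjective φ := fun a => by
    obtain ⟨d, hd⟩ := exists_forall_mem_of_antitone (S := fun n => {d : D | (φ d)⁻¹ * a ∈ U n})
      (fun m n hmn d hd => hanti hmn hd) (fun n => hdense n a)
      (fun n => ((U n).isClosed_of_isOpen (hU n)).preimage (hφ.inv.mul continuous_const))
    exact ⟨d, inv_mul_eq_one.mp (hsep _ hd)⟩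
  let e := MulEquiv.ofBijective φ ⟨hinj, hsurj⟩
  exact ⟨{ e with
    continuous_toFun := hφ
    continuous_invFun :=
      (Continuous.homeoOfEquivCompactToT2 (f := e.toEquiv) hφ).continuous_invFun }, fun _ => rfl⟩

theorem isClosed_setOf_mem_iff_mem {U : Subgroup A} {V : Subgroup G} (hU : IsOpen (U : Set A))
    (hV : IsOpen (V : Set G)) : IsClosed {d : A × G | d.1 ∈ U ↔ d.2 ∈ V} := by
  have hU' : IsClopen {d : A × G | d.1 ∈ U} :=
    IsClopen.preimage ⟨U.isClosed_of_isOpen hU, hU⟩ continuous_fst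
  have hV' : IsClopen {d : A × G | d.2 ∈ V} :=
    IsClopen.preimage ⟨V.isClosed_of_isOpen hV, hV⟩ continuous_snd
  simp only [iff_iff_implies_and_implies, imp_iff_not_or]
  exact ((hU'.compl.union hV').inter (hV'.compl.union hU')).isClosed

/-- The isomorphism is read off from the closure of `{(α m, β m)}` in `A × G`, whose projections
to both factors are isomorphisms. -/
theorem exists_continuousMulEquiv_of_filtrations [CompactSpace A] [T2Space A] [CompactSpace G]
    [T2Space G] {M : Type*} [Group M] (α : M →* A) (β : M →* G) (U : ℕ → Subgroup A)
    (V : ℕ → Subgroup G) (hU : ∀ n, IsOpen (U n : Set A)) (hV : ∀ n, IsOpen (V n : Set G))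
    (hUa : Antitone U) (hVa : Antitone V) (hU1 : ∀ a, (∀ n, a ∈ U n) → a = 1)
    (hV1 : ∀ g, (∀ n, g ∈ V n) → g = 1) (hα : ∀ n a, ∃ m, (α m)⁻¹ * a ∈ U n)
    (hβ : ∀ n g, ∃ m, (β m)⁻¹ * g ∈ V n) (h : ∀ n m, α m ∈ U n ↔ β m ∈ V n) :
    ∃ φ : G ≃ₜ* A, ∀ m, φ (β m) = α m := by
  let D : Subgroup (A × G) := (α.prod β).range.topologicalClosure
  have hDm (m : M) : (α m, β m) ∈ D := Subgroup.le_topologicalClosure _ ⟨m, rfl⟩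
  have : CompactSpace D :=
    isCompact_iff_compactSpace.mp (Subgroup.isClosed_topologicalClosure _).isCompact
  have hD (d : D) (n : ℕ) : d.1.1 ∈ U n ↔ d.1.2 ∈ V n := by
    refine closure_minimal ?_ (isClosed_setOf_mem_iff_mem (hU n) (hV n)) d.2
    rintro _ ⟨m, rfl⟩
    exact h n m
  let φ₁ : D →* A := (MonoidHom.fst A G).comp D.subtype
  let φ₂ : D →* G := (MonoidHom.snd A G).comp D.subtype
  have hinj₁ : Function.Injective φ₁ := (injective_iff_map_eq_one φ₁).mpr fun d hd =>
    Subtype.ext (Prod.ext hd (hV1 _ fun n => (hD d n).mp (by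
      rw [show d.1.1 = 1 from hd]
      exact one_mem _)))
  have hinj₂ : Function.Injective φ₂ := (injective_iff_map_eq_one φ₂).mpr fun d hd =>
    Subtype.ext (Prod.ext (hU1 _ fun n => (hD d n).mpr (by
      rw [show d.1.2 = 1 from hd]
      exact one_mem _)) hd)
  obtain ⟨e₁, he₁⟩ := exists_continuousMulEquiv_of_injective_of_dense (φ := φ₁)
    (continuous_fst.comp continuous_subtype_val) hinj₁ hU hUa hU1
    (fun n a => (hα n a).imp' (fun m => ⟨_, hDm m⟩) fun m hm => hm)
  obtain ⟨e₂, he₂⟩ := exists_continuousMulEquiv_of_injective_of_dense (φ := φ₂)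
    (continuous_snd.comp continuous_subtype_val) hinj₂ hV hVa hV1
    (fun n g => (hβ n g).imp' (fun m => ⟨_, hDm m⟩) fun m hm => hm)
  refine ⟨e₂.symm.trans e₁, fun m => ?_⟩
  have hm : e₂.symm (β m) = ⟨_, hDm m⟩ := by
    rw [ContinuousMulEquiv.symm_apply_eq, he₂]
    rfl
  rw [ContinuousMulEquiv.trans_apply, hm, he₁]
  rfl

end Completion

/-! ### Compact groups with a tame and a wild generator -/

section Group

variable {G : Type*} [Group G]

theorem exists_inv_pow_mul_mem (N : Subgroup G) [N.Normal] [N.FiniteIndex] {g : G}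
    (hg : ∀ k : ℕ, g ^ k ∈ N → N.index ∣ k) (x : G) : ∃ k : ℕ, (g ^ k)⁻¹ * x ∈ N := by
  have hord : orderOf (g : G ⧸ N) = Nat.card (G ⧸ N) := by
    refine (orderOf_dvd_natCard _).antisymm (hg _ ?_)
    rw [← QuotientGroup.eq_one_iff, QuotientGroup.mk_pow, pow_orderOf_eq_one]
  have htop : Subgroup.zpowers (g : G ⧸ N) = ⊤ :=
    Subgroup.eq_top_of_card_eq _ (by rw [Nat.card_zpowers, hord])
  obtain ⟨k, hk⟩ := mem_powers_iff_mem_zpowers.mpr (htop ▸ Subgroup.mem_top (x : G ⧸ N))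
  exact ⟨k, QuotientGroup.eq.mp hk⟩

theorem exists_forall_pow_mem_imp_index_dvd {R : Type*} [CommRing R] [IsDomain R]
    {N : Subgroup G} [N.FiniteIndex] {χ : G →* R} (hχ : ∀ g, χ g = 1 ↔ g ∈ N) :
    ∃ g : G, ∀ k : ℕ, g ^ k ∈ N → N.index ∣ k := by
  obtain rfl : χ.ker = N := Subgroup.ext hχ
  let ψ : G ⧸ χ.ker →* R := QuotientGroup.lift χ.ker χ fun _ => (hχ _).mpr
  have hψ : Function.Injective ψ := (injective_iff_map_eq_one ψ).mpr fun x => by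
    obtain ⟨g, rfl⟩ := QuotientGroup.mk_surjective x
    exact (QuotientGroup.eq_one_iff (N := χ.ker) g).mpr
  have : IsCyclic (G ⧸ χ.ker) := isCyclic_of_injective_ringHom ψ hψ
  obtain ⟨x, hx⟩ := IsCyclic.exists_generator (α := G ⧸ χ.ker)
  obtain ⟨g, rfl⟩ := QuotientGroup.mk_surjective x
  have hindex : orderOf (g : G ⧸ χ.ker) = χ.ker.index := orderOf_eq_card_of_forall_mem_zpowers hx
  refine ⟨g, fun k hk => hindex ▸ orderOf_dvd_of_pow_eq_one ?_⟩
  rwa [← QuotientGroup.mk_pow, QuotientGroup.eq_one_iff]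

theorem pow_pow_eq_self {x : G} {q : ℕ} (hq : q ≠ 0) (hx : x ^ (q - 1) = 1) (n : ℕ) :
    x ^ q ^ n = x := by
  induction n with
  | zero => rw [pow_zero, pow_one]
  | succ n ih => rw [pow_succ, pow_mul, ih, ← pow_sub_one_mul hq, hx, one_mul]

theorem semiconjBy_pow_pow {w u : G} {a : ℕ} (h : SemiconjBy w u (u ^ a)) (k : ℕ) :
    SemiconjBy (w ^ k) u (u ^ a ^ k) := by
  induction k with
  | zero => simp only [pow_zero, pow_one, SemiconjBy.one_left]
  | succ k ih =>
    rw [pow_succ' w, pow_succ' a, pow_mul]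
    exact (h.pow_right (a ^ k)).mul_left ih

theorem commute_of_semiconjBy_pow {w u : G} {m n a : ℕ} (hm : p.Coprime m) (hw : w ^ m = 1)
    (hu : orderOf u = p ^ n) (ha : p ∣ a) (h : SemiconjBy w u (u ^ (a + 1))) : Commute w u := by
  have hpow := semiconjBy_pow_pow h m
  rw [hw, SemiconjBy, one_mul, mul_one, ← pow_one u, ← pow_mul, one_mul] at hpow
  have hdvd : (p : ℤ) ^ n ∣ (a + 1) ^ m - 1 ^ m := by
    simpa [hu] using (pow_eq_pow_iff_modEq.mp hpow).dvd
  have hpZ : Prime (p : ℤ) := Nat.prime_iff_prime_int.mp Fact.out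
  have haZ : (p : ℤ) ∣ a := Int.natCast_dvd_natCast.mpr ha
  have hsub : (p : ℤ) ∣ (a + 1) - 1 := by rwa [add_sub_cancel_right]
  have hnot : ¬ (p : ℤ) ∣ a + 1 := fun h1 => hpZ.not_dvd_one ((Int.dvd_add_right haZ).mp h1)
  rw [pow_dvd_iff_le_emultiplicity, emultiplicity_pow_sub_pow_of_prime hpZ hsub hnot
      (Int.natCast_dvd_natCast.not.mpr ((Fact.out : p.Prime).coprime_iff_not_dvd.mp hm)),
    ← pow_dvd_iff_le_emultiplicity, add_sub_cancel_right] at hdvd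
  have hua : u ^ a = 1 := orderOf_dvd_iff_pow_eq_one.mp (hu ▸ by exact_mod_cast hdvd)
  rwa [pow_succ, hua, one_mul] at h

end Group

/-- A filtration of `G` by open normal subgroups of index `p^n (p-1)`, whose tame quotient
`G / H 0` is cyclic and for which `u` generates `H 0` topologically and is central modulo `H 1`. -/
structure IsTameWild (p : ℕ) {G : Type*} [Group G] [TopologicalSpace G] (H : ℕ → Subgroup G)
    (u : G) : Prop where
  normal : ∀ n, (H n).Normal
  isOpen : ∀ n, IsOpen (H n : Set G)
  anti : Antitone H
  sep : ∀ g, (∀ n, g ∈ H n) → g = 1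
  index : ∀ n, (H n).index = p ^ n * (p - 1)
  mem : u ∈ H 0
  dvd_of_pow_mem : ∀ n k : ℕ, u ^ k ∈ H n → p ^ n ∣ k
  conj : ∀ σ (a : ℕ), (u ^ (a + 1))⁻¹ * (σ * u * σ⁻¹) ∈ H 1 → p ∣ a
  exists_generator : ∃ σ : G, ∀ k : ℕ, σ ^ k ∈ H 0 → p - 1 ∣ k

namespace IsTameWild

variable {G : Type*} [Group G] [TopologicalSpace G] {H : ℕ → Subgroup G} {u : G}
  (h : IsTameWild p H u)

include h

omit [Fact p.Prime] in
theorem index_zero : (H 0).index = p - 1 := by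
  rw [h.index, pow_zero, one_mul]

theorem relIndex (n : ℕ) : (H n).relIndex (H 0) = p ^ n := by
  have hmul := Subgroup.relIndex_mul_index (h.anti (Nat.zero_le n))
  rw [h.index_zero, h.index] at hmul
  exact Nat.eq_of_mul_eq_mul_right (Nat.sub_pos_of_lt (Fact.out : p.Prime).one_lt) hmul

theorem pow_mem_of_mem {g : G} (hg : g ∈ H 0) (n : ℕ) : g ^ p ^ n ∈ H n := by
  have := h.normal n
  have hpow := Subgroup.pow_index_mem ((H n).subgroupOf (H 0)) ⟨g, hg⟩
  rwa [← Subgroup.relIndex, h.relIndex, Subgroup.mem_subgroupOf] at hpow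

theorem eq_one_of_mem_of_pow_eq_one {g : G} (hg : g ∈ H 0) (hg1 : g ^ (p - 1) = 1) : g = 1 := by
  refine h.sep g fun n => ?_
  rw [← pow_pow_eq_self (Fact.out : p.Prime).ne_zero hg1 n]
  exact h.pow_mem_of_mem hg n

theorem zpow_mem_iff (n : ℕ) (k : ℤ) : u ^ k ∈ H n ↔ ((p ^ n : ℕ) : ℤ) ∣ k := by
  constructor
  · refine fun hk => Int.natCast_dvd.mpr (h.dvd_of_pow_mem n _ ?_)
    rcases Int.natAbs_eq k with hk' | hk' <;> rw [hk'] at hk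
    · rwa [zpow_natCast] at hk
    · rwa [zpow_neg, zpow_natCast, inv_mem_iff] at hk
  · rintro ⟨c, rfl⟩
    rw [zpow_mul, zpow_natCast]
    exact (H n).zpow_mem (h.pow_mem_of_mem h.mem n) c

theorem exists_inv_pow_mul_mem_of_mem {g : G} (hg : g ∈ H 0) (n : ℕ) :
    ∃ k : ℕ, (u ^ k)⁻¹ * g ∈ H n := by
  have := h.normal n
  have hindex : ((H n).subgroupOf (H 0)).index = p ^ n := h.relIndex n
  have : ((H n).subgroupOf (H 0)).FiniteIndex :=
    ⟨hindex ▸ pow_ne_zero n (Fact.out : p.Prime).ne_zero⟩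
  exact exists_inv_pow_mul_mem ((H n).subgroupOf (H 0)) (g := ⟨u, h.mem⟩)
    (fun k hk => hindex ▸ h.dvd_of_pow_mem n k hk) ⟨g, hg⟩

theorem orderOf_mk (n : ℕ) [(H n).Normal] : orderOf (u : G ⧸ H n) = p ^ n := by
  refine Nat.dvd_antisymm (orderOf_dvd_of_pow_eq_one ?_) (h.dvd_of_pow_mem _ _ ?_)
  · rw [← QuotientGroup.mk_pow, QuotientGroup.eq_one_iff]
    exact h.pow_mem_of_mem h.mem n
  · rw [← QuotientGroup.eq_one_iff, QuotientGroup.mk_pow, pow_orderOf_eq_one]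

theorem commute_of_pow_eq_one {w : G} (hw : w ^ (p - 1) = 1) : Commute w u := by
  suffices hmem : ∀ n, (u * w)⁻¹ * (w * u) ∈ H (n + 1) from
    (inv_mul_eq_one.mp (h.sep _ fun n => h.anti n.le_succ (hmem n))).symm
  intro n
  have := h.normal (n + 1)
  have hconj : u⁻¹ * (w * u * w⁻¹) ∈ H 0 :=
    mul_mem (inv_mem h.mem) ((h.normal 0).conj_mem u h.mem w)
  obtain ⟨a, ha⟩ := h.exists_inv_pow_mul_mem_of_mem hconj (n + 1)
  rw [← mul_assoc, ← mul_inv_rev, ← pow_succ'] at ha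
  have hpa : p ∣ a := h.conj w a (h.anti (Nat.le_add_left 1 n) ha)
  have hsemi : SemiconjBy (w : G ⧸ H (n + 1)) u ((u : G ⧸ H (n + 1)) ^ (a + 1)) :=
    mul_inv_eq_iff_eq_mul.mp (QuotientGroup.eq.mpr ha).symm
  have hw' : (w : G ⧸ H (n + 1)) ^ (p - 1) = 1 := by
    rw [← QuotientGroup.mk_pow, hw, QuotientGroup.mk_one]
  exact QuotientGroup.eq.mp
    (commute_of_semiconjBy_pow coprime_prime_sub_one hw' (h.orderOf_mk (n + 1)) hpa hsemi).eq.symm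

theorem exists_pow_eq_one_inv_mul_mem [IsTopologicalGroup G] [CompactSpace G] (σ : G) :
    ∃ w : G, w ^ (p - 1) = 1 ∧ σ⁻¹ * w ∈ H 0 := by
  have := h.normal
  let S (n : ℕ) : Set G := {w | w ^ (p - 1) ∈ H n ∧ σ⁻¹ * w ∈ H 0}
  have hne (n : ℕ) : (S n).Nonempty := by
    refine ⟨σ ^ p ^ n, ?_, QuotientGroup.eq.mp ?_⟩
    · rw [← pow_mul, ← h.index n]
      exact Subgroup.pow_index_mem (H n) σ
    · rw [QuotientGroup.mk_pow, pow_pow_eq_self (Fact.out : p.Prime).ne_zero]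
      rw [← QuotientGroup.mk_pow, QuotientGroup.eq_one_iff, ← h.index_zero]
      exact Subgroup.pow_index_mem (H 0) σ
  have hcl (n : ℕ) : IsClosed (H n : Set G) := (H n).isClosed_of_isOpen (h.isOpen n)
  obtain ⟨w, hw⟩ := exists_forall_mem_of_antitone
    (fun m n hmn w (hw : w ∈ S n) => ⟨h.anti hmn hw.1, hw.2⟩) hne
    (fun n => ((hcl n).preimage (continuous_pow _)).inter
      ((hcl 0).preimage (continuous_const.mul continuous_id)))
  exact ⟨w, h.sep _ fun n => (hw n).1, (hw 0).2⟩

theorem exists_orderOf_eq [IsTopologicalGroup G] [CompactSpace G] :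
    ∃ w : G, orderOf w = p - 1 := by
  have := h.normal 0
  obtain ⟨σ, hσ⟩ := h.exists_generator
  obtain ⟨w, hw, hσw⟩ := h.exists_pow_eq_one_inv_mul_mem σ
  refine ⟨w, Nat.dvd_antisymm (orderOf_dvd_of_pow_eq_one hw) (hσ _ ?_)⟩
  rw [← QuotientGroup.eq_one_iff, QuotientGroup.mk_pow, QuotientGroup.eq.mpr hσw,
    ← QuotientGroup.mk_pow, pow_orderOf_eq_one, QuotientGroup.mk_one]

section OrderOf

variable {w : G} (hw : orderOf w = p - 1)

include hw

theorem zpow_mul_zpow_mem_iff (n : ℕ) (i j : ℤ) :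
    w ^ i * u ^ j ∈ H n ↔ ((p - 1 : ℕ) : ℤ) ∣ i ∧ ((p ^ n : ℕ) : ℤ) ∣ j := by
  rw [← hw, orderOf_dvd_iff_zpow_eq_one, ← h.zpow_mem_iff]
  refine ⟨fun hm => ?_, fun ⟨hi, hj⟩ => by rwa [hi, one_mul]⟩
  have hi : w ^ i = 1 := by
    refine h.eq_one_of_mem_of_pow_eq_one ?_ ?_
    · exact ((H 0).mul_mem_cancel_right ((H 0).zpow_mem h.mem j)).mp (h.anti (Nat.zero_le n) hm)
    · rw [← zpow_natCast, zpow_comm, zpow_natCast, ← hw, pow_orderOf_eq_one, one_zpow]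
  rw [hi, one_mul] at hm
  exact ⟨hi, hm⟩

theorem exists_inv_pow_mul_pow_mul_mem (n : ℕ) (g : G) :
    ∃ i j : ℕ, (w ^ i * u ^ j)⁻¹ * g ∈ H n := by
  have := h.normal 0
  have : (H 0).FiniteIndex :=
    ⟨h.index_zero ▸ (Nat.sub_pos_of_lt (Fact.out : p.Prime).one_lt).ne'⟩
  have hdvd (k : ℕ) (hk : w ^ k ∈ H 0) : (H 0).index ∣ k := by
    rw [h.index_zero, ← Int.natCast_dvd_natCast]
    refine ((h.zpow_mul_zpow_mem_iff hw 0 k 0).mp ?_).1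
    rwa [zpow_zero, mul_one, zpow_natCast]
  obtain ⟨i, hi⟩ := exists_inv_pow_mul_mem (H 0) hdvd g
  obtain ⟨j, hj⟩ := h.exists_inv_pow_mul_mem_of_mem hi n
  exact ⟨i, j, by rwa [mul_inv_rev, mul_assoc]⟩

end OrderOf

theorem exists_forall_dvd_of_pow_mem [IsTopologicalGroup G] [CompactSpace G] :
    ∃ g : G, ∀ n k : ℕ, g ^ k ∈ H n → p ^ n * (p - 1) ∣ k := by
  obtain ⟨w, hw⟩ := h.exists_orderOf_eq
  have hwu : Commute w u := h.commute_of_pow_eq_one (hw ▸ pow_orderOf_eq_one w)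
  refine ⟨w * u, fun n k hk => ?_⟩
  rw [hwu.mul_pow, ← zpow_natCast, ← zpow_natCast, h.zpow_mul_zpow_mem_iff hw,
    Int.natCast_dvd_natCast, Int.natCast_dvd_natCast] at hk
  exact (coprime_prime_sub_one.pow_left n).mul_dvd_of_dvd_of_dvd hk.2 hk.1

theorem exists_continuousMulEquiv [IsTopologicalGroup G] [CompactSpace G] [T2Space G] {w : G}
    (hw : orderOf w = p - 1) {A : Type*} [Group A] [TopologicalSpace A] [IsTopologicalGroup A]
    [CompactSpace A] [T2Space A] {U : ℕ → Subgroup A} {u' w' : A} (h' : IsTameWild p U u')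
    (hw' : orderOf w' = p - 1) : ∃ φ : G ≃ₜ* A, φ w = w' ∧ φ u = u' := by
  have hwu : Commute w u := h.commute_of_pow_eq_one (hw ▸ pow_orderOf_eq_one w)
  have hwu' : Commute w' u' := h'.commute_of_pow_eq_one (hw' ▸ pow_orderOf_eq_one w')
  let β : Multiplicative ℤ × Multiplicative ℤ →* G :=
    MonoidHom.noncommCoprod (zpowersHom G w) (zpowersHom G u) fun i j => hwu.zpow_zpow _ _
  let α : Multiplicative ℤ × Multiplicative ℤ →* A :=
    MonoidHom.noncommCoprod (zpowersHom A w') (zpowersHom A u') fun i j => hwu'.zpow_zpow _ _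
  have hα (i j : ℕ) : α (.ofAdd (i : ℤ), .ofAdd (j : ℤ)) = w' ^ i * u' ^ j :=
    congrArg₂ _ (zpow_natCast w' i) (zpow_natCast u' j)
  have hβ (i j : ℕ) : β (.ofAdd (i : ℤ), .ofAdd (j : ℤ)) = w ^ i * u ^ j :=
    congrArg₂ _ (zpow_natCast w i) (zpow_natCast u j)
  have hα_dense (n : ℕ) (a : A) : ∃ m, (α m)⁻¹ * a ∈ U n := by
    obtain ⟨i, j, hij⟩ := h'.exists_inv_pow_mul_pow_mul_mem hw' n a
    exact ⟨_, (hα i j).symm ▸ hij⟩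
  have hβ_dense (n : ℕ) (g : G) : ∃ m, (β m)⁻¹ * g ∈ H n := by
    obtain ⟨i, j, hij⟩ := h.exists_inv_pow_mul_pow_mul_mem hw n g
    exact ⟨_, (hβ i j).symm ▸ hij⟩
  obtain ⟨φ, hφ⟩ := exists_continuousMulEquiv_of_filtrations α β U H h'.isOpen h.isOpen h'.anti
    h.anti h'.sep h.sep hα_dense hβ_dense fun n m =>
      (h'.zpow_mul_zpow_mem_iff hw' n _ _).trans (h.zpow_mul_zpow_mem_iff hw n _ _).symm
  have hφ' (i j : ℕ) : φ (w ^ i * u ^ j) = w' ^ i * u' ^ j := by rw [← hα, ← hβ, hφ]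
  exact ⟨φ, by simpa using hφ' 1 0, by simpa using hφ' 0 1⟩

end IsTameWild

/-- The filtration of `ℤ/(p-1) × ℤ_p` by the subgroups `0 × p^n ℤ_p`. -/
noncomputable def padicFiltration (p : ℕ) [Fact p.Prime] (n : ℕ) :
    Subgroup (Multiplicative (ZMod (p - 1)) × Multiplicative ℤ_[p]) :=
  ((MonoidHom.id _).prodMap (PadicInt.toZModPow n).toAddMonoidHom.toMultiplicative).ker

theorem mem_padicFiltration {n : ℕ} {a : Multiplicative (ZMod (p - 1)) × Multiplicative ℤ_[p]} :
    a ∈ padicFiltration p n ↔ a.1 = 1 ∧ PadicInt.toZModPow n a.2.toAdd = 0 :=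
  Prod.ext_iff

theorem index_padicFiltration (n : ℕ) : (padicFiltration p n).index = p ^ n * (p - 1) := by
  have hsurj : Function.Surjective ((MonoidHom.id (Multiplicative (ZMod (p - 1)))).prodMap
      (PadicInt.toZModPow (p := p) n).toAddMonoidHom.toMultiplicative) :=
    Function.surjective_id.prodMap (ZMod.ringHom_surjective (PadicInt.toZModPow n))
  rw [padicFiltration, Subgroup.index_ker, MonoidHom.range_eq_top.mpr hsurj,
    Nat.card_congr Subgroup.topEquiv.toEquiv, Nat.card_prod, mul_comm]
  exact congrArg₂ _ (Nat.card_zmod _) (Nat.card_zmod _)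

theorem isOpen_padicFiltration (n : ℕ) :
    IsOpen (padicFiltration p n : Set (Multiplicative (ZMod (p - 1)) × Multiplicative ℤ_[p])) := by
  have hball : {z : ℤ_[p] | PadicInt.toZModPow n z = 0} =
      Metric.closedBall 0 ((p : ℝ) ^ (-n : ℤ)) := by
    ext z
    rw [Set.mem_ofPred_eq, ← RingHom.mem_ker, PadicInt.ker_toZModPow, mem_closedBall_zero_iff,
      PadicInt.norm_le_pow_iff_mem_span_pow]
  have hopen : IsOpen {z : ℤ_[p] | PadicInt.toZModPow n z = 0} :=
    hball ▸ IsUltrametricDist.isOpen_closedBall _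
      (zpow_ne_zero _ (Nat.cast_ne_zero.mpr (Fact.out : p.Prime).ne_zero))
  have heq : (padicFiltration p n : Set (Multiplicative (ZMod (p - 1)) × Multiplicative ℤ_[p])) =
      {1} ×ˢ (Multiplicative.toAdd ⁻¹' {z : ℤ_[p] | PadicInt.toZModPow n z = 0}) :=
    Set.ext fun _ => mem_padicFiltration
  exact heq ▸ (isOpen_discrete {1}).prod (hopen.preimage continuous_toAdd)

theorem dvd_of_pow_mem_padicFiltration {n k : ℕ}
    (hk : (1, Multiplicative.ofAdd 1) ^ k ∈ padicFiltration p n) : p ^ n ∣ k := by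
  have hk0 : PadicInt.toZModPow n (k • (1 : ℤ_[p])) = 0 := (mem_padicFiltration.mp hk).2
  rwa [nsmul_one, map_natCast, ZMod.natCast_eq_zero_iff] at hk0

theorem isTameWild_padicFiltration :
    IsTameWild p (padicFiltration p) (1, Multiplicative.ofAdd 1) where
  normal n := MonoidHom.normal_ker _
  isOpen := isOpen_padicFiltration
  anti m n hmn a ha := by
    rw [mem_padicFiltration] at ha ⊢
    refine ⟨ha.1, ?_⟩
    rw [← PadicInt.zmod_cast_comp_toZModPow m n hmn, RingHom.comp_apply, ha.2, map_zero]
  sep a ha := Prod.ext (mem_padicFiltration.mp (ha 0)).1 <| Multiplicative.toAdd.injective <|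
    PadicInt.ext_of_toZModPow.mp fun n =>
      (mem_padicFiltration.mp (ha n)).2.trans (map_zero (PadicInt.toZModPow n)).symm
  index := index_padicFiltration
  mem := mem_padicFiltration.mpr ⟨rfl, Subsingleton.elim (α := ZMod 1) _ _⟩
  dvd_of_pow_mem _ _ := dvd_of_pow_mem_padicFiltration
  conj σ a ha := by
    rw [mul_right_comm, mul_inv_cancel, one_mul, pow_succ, mul_inv_rev, inv_mul_cancel_comm,
      inv_mem_iff] at ha
    simpa using dvd_of_pow_mem_padicFiltration ha
  exists_generator := by
    refine ⟨(Multiplicative.ofAdd 1, 1), fun k hk => ?_⟩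
    have hk1 : k • (1 : ZMod (p - 1)) = 0 := (mem_padicFiltration.mp hk).1
    rwa [nsmul_one, ZMod.natCast_eq_zero_iff] at hk1

theorem orderOf_ofAdd_one_one (p : ℕ) [Fact p.Prime] :
    orderOf ((Multiplicative.ofAdd 1, 1) :
      Multiplicative (ZMod (p - 1)) × Multiplicative ℤ_[p]) = p - 1 := by
  rw [Prod.orderOf_mk, orderOf_one, Nat.lcm_one_right, orderOf_ofAdd_eq_addOrderOf,
    ZMod.addOrderOf_one]

theorem IsTameWild.exists_continuousMulEquiv_zmod_prod_padicInt {G : Type*} [Group G]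
    [TopologicalSpace G] [IsTopologicalGroup G] [CompactSpace G] [T2Space G] {H : ℕ → Subgroup G}
    {u w : G} (h : IsTameWild p H u) (hw : orderOf w = p - 1) :
    ∃ φ : G ≃ₜ* Multiplicative (ZMod (p - 1)) × Multiplicative ℤ_[p],
      φ w = (Multiplicative.ofAdd 1, 1) ∧ φ u = (1, Multiplicative.ofAdd 1) := by
  have : NeZero (p - 1) := ⟨(Nat.sub_pos_of_lt (Fact.out : p.Prime).one_lt).ne'⟩
  exact h.exists_continuousMulEquiv hw isTameWild_padicFiltration (orderOf_ofAdd_one_one p)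

/-! ### Stabilizers in Galois groups -/

section Stabilizer

variable {F L : Type*} [Field F] [Field L] [Algebra F L]

theorem mem_fixingSubgroup_adjoin_iff {S : Set L} {σ : Gal(L/F)} :
    σ ∈ (IntermediateField.adjoin F S).fixingSubgroup ↔ ∀ x ∈ S, σ x = x := by
  rw [IntermediateField.mem_fixingSubgroup_iff]
  refine ⟨fun h x hx => h x (IntermediateField.subset_adjoin F S hx), fun h y hy => ?_⟩
  induction hy using IntermediateField.adjoin_induction with
  | mem x hx => exact h x hx
  | algebraMap x => exact σ.commutes x
  | add x y _ _ hx hy => rw [map_add, hx, hy]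
  | inv x _ hx => rw [map_inv₀, hx]
  | mul x y _ _ hx hy => rw [map_mul, hx, hy]

theorem stabilizer_eq_fixingSubgroup_adjoin (x : L) :
    MulAction.stabilizer Gal(L/F) x = (IntermediateField.adjoin F {x}).fixingSubgroup := by
  ext σ
  rw [MulAction.mem_stabilizer_iff, AlgEquiv.smul_def, mem_fixingSubgroup_adjoin_iff]
  simp only [Set.mem_singleton_iff, forall_eq]

theorem apply_eq_self_of_mem_adjoin {σ : Gal(L/F)} {x y : L} (hσ : σ x = x)
    (hy : y ∈ IntermediateField.adjoin F {x}) : σ y = y := by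
  have hmem : σ ∈ (IntermediateField.adjoin F {x}).fixingSubgroup :=
    stabilizer_eq_fixingSubgroup_adjoin (F := F) x ▸ MulAction.mem_stabilizer_iff.mpr hσ
  exact (IntermediateField.mem_fixingSubgroup_iff _ σ).mp hmem y hy

theorem apply_mem_adjoin {x : L} [Normal F (IntermediateField.adjoin F {x})] (σ : Gal(L/F)) :
    σ x ∈ IntermediateField.adjoin F {x} := by
  have h := AlgHom.restrictNormal_commutes (σ : L →ₐ[F] L) (IntermediateField.adjoin F {x})
    (IntermediateField.AdjoinSimple.gen F x)
  exact h ▸ SetLike.coe_mem _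

theorem isClosed_setOf_apply_eq [Algebra.IsIntegral F L] (x y : L) :
    IsClosed {σ : Gal(L/F) | σ x = y} := by
  rcases Set.eq_empty_or_nonempty {σ : Gal(L/F) | σ x = y} with h | ⟨τ, rfl⟩
  · exact h ▸ isClosed_empty
  · have hcoset : {σ : Gal(L/F) | σ x = τ x} =
        (τ⁻¹ * ·) ⁻¹' (MulAction.stabilizer Gal(L/F) x : Set Gal(L/F)) := by
      ext σ
      exact (inv_smul_eq_iff (g := τ) (a := σ • x) (b := x)).symm
    rw [hcoset]
    exact (Subgroup.isClosed_of_isOpen _ (stabilizer_isOpen_of_isIntegral x)).preimage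
      (continuous_const_mul _)

theorem index_stabilizer [IsGalois F L] (x : L) :
    (MulAction.stabilizer Gal(L/F) x).index = (minpoly F x).natDegree := by
  rw [stabilizer_eq_fixingSubgroup_adjoin, ← IntermediateField.finrank_eq_fixingSubgroup_index,
    IntermediateField.adjoin.finrank (Algebra.IsIntegral.isIntegral x)]

end Stabilizer

/-! ### The field `K` -/

section Lam

variable {f : ℤ_[p]⟦X⟧} {n : ℕ} {x : PadicAlgCl p}

theorem mem_lam_iff : x ∈ Lam f n ↔ ‖x‖ < 1 ∧ ev x (iter f n) = 0 :=
  and_congr_right fun hx => hasValueAt_iff hx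

theorem mem_lam_of_mem_prim (hx : x ∈ Prim f n) : x ∈ Lam f (n + 1) :=
  mem_lam_iff.mpr ⟨hx.1, hx.2.2⟩

theorem mem_lamAll_of_mem_prim (hx : x ∈ Prim f n) : x ∈ LamAll f :=
  Set.mem_iUnion_of_mem (n + 1) (mem_lam_of_mem_prim hx)

theorem zero_mem_lamAll (f : ℤ_[p]⟦X⟧) : (0 : PadicAlgCl p) ∈ LamAll f :=
  Set.mem_iUnion_of_mem 0 (mem_lam_iff.mpr ⟨by simp, by rw [iter, ev_X]⟩)

theorem norm_lt_one_of_mem_lamAll (hx : x ∈ LamAll f) : ‖x‖ < 1 := by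
  obtain ⟨n, hn⟩ := Set.mem_iUnion.mp hx
  exact hn.1

theorem eq_zero_or_mem_prim_of_mem_lam (hx : x ∈ Lam f n) : x = 0 ∨ ∃ k < n, x ∈ Prim f k := by
  rw [mem_lam_iff] at hx
  induction n with
  | zero => exact Or.inl (by rw [← hx.2, iter, ev_X])
  | succ n ih =>
    by_cases h : ev x (iter f n) = 0
    · exact (ih ⟨hx.1, h⟩).imp_right fun ⟨k, hk, hxk⟩ => ⟨k, hk.trans n.lt_succ_self, hxk⟩
    · exact Or.inr ⟨n, n.lt_succ_self, hx.1, h, hx.2⟩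

theorem galois_mem_lamAll (σ : Gal(PadicAlgCl p/ℚ_[p])) (hx : x ∈ LamAll f) : σ x ∈ LamAll f := by
  obtain ⟨n, hn⟩ := Set.mem_iUnion.mp hx
  rw [mem_lam_iff] at hn
  refine Set.mem_iUnion_of_mem n (mem_lam_iff.mpr ⟨by rw [norm_galois]; exact hn.1, ?_⟩)
  rw [← galois_ev σ hn.1, hn.2, map_zero]

end Lam

instance isGalois_K (f : ℤ_[p]⟦X⟧) : IsGalois ℚ_[p] (K f) := by
  have : Normal ℚ_[p] (K f) := by
    refine IntermediateField.normal_iff_forall_map_le'.mpr fun σ => ?_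
    rw [IntermediateField.adjoin_map]
    refine IntermediateField.adjoin.mono _ _ _ ?_
    rintro _ ⟨x, hx, rfl⟩
    exact galois_mem_lamAll σ hx
  exact ⟨⟩

theorem restrictNormalHom_K_apply {f : ℤ_[p]⟦X⟧} (σ : Gal(PadicAlgCl p/ℚ_[p])) (y : K f) :
    (AlgEquiv.restrictNormalHom (K f) σ y : PadicAlgCl p) = σ y :=
  σ.restrictNormal_commutes (K f) y

namespace IsConsistent

variable {f : ℤ_[p]⟦X⟧} {π : ℕ → PadicAlgCl p} (hπ : IsConsistent f π)

include hπ

theorem norm_lt_one (n : ℕ) : ‖π n‖ < 1 :=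
  norm_lt_one_of_mem_lamAll (hπ.mem n)

theorem ev_succ (n : ℕ) : ev (π (n + 1)) f = π n :=
  (hasValueAt_iff (hπ.norm_lt_one _)).mp (hπ.step n)

theorem ev_iter_add (hf0 : coeff 0 f = 0) (n m : ℕ) : ev (π (n + m)) (iter f m) = π n := by
  induction m generalizing n with
  | zero => rw [iter, ev_X, add_zero]
  | succ m ih => rw [ev_iter_succ hf0 _ (hπ.norm_lt_one _), ← add_assoc, add_right_comm, ih,
      hπ.ev_succ]

theorem mem_prim (hf0 : coeff 0 f = 0) (n : ℕ) : π (n + 1) ∈ Prim f n := by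
  refine ⟨hπ.norm_lt_one _, ?_, ?_⟩
  · rw [add_comm, hπ.ev_iter_add hf0]
    exact hπ.one_ne
  · rw [← hπ.zero, ← hπ.ev_iter_add hf0 0 (n + 1), zero_add]

end IsConsistent

theorem IsHeightOne.exists_isConsistent {f : ℤ_[p]⟦X⟧} (hf : IsHeightOne f) :
    ∃ π : ℕ → PadicAlgCl p, IsConsistent f π := by
  obtain ⟨x₀, hx₀⟩ := hf.prim_nonempty 0
  choose! next hmem hev using fun (n : ℕ) (x : PadicAlgCl p) (hx : x ∈ Prim f n) =>
    hf.exists_mem_prim_succ_ev_eq hx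
  let s (n : ℕ) : PadicAlgCl p := Nat.rec x₀ next n
  have hs (n : ℕ) : s n ∈ Prim f n := by
    induction n with
    | zero => exact hx₀
    | succ n ih => exact hmem n _ ih
  have hev₀ : ev x₀ f = 0 := by
    have h := hx₀.2.2
    rwa [ev_iter_succ hf.coeff_zero _ hx₀.1, iter, ev_X] at h
  refine ⟨fun n => Nat.casesOn n 0 s, ?_, rfl, ?_, ?_⟩
  · rintro (_ | n)
    · exact zero_mem_lamAll f
    · exact mem_lamAll_of_mem_prim (hs n)
  · exact hf.ne_zero_of_mem_prim hx₀
  · rintro (_ | n)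
    · exact (hasValueAt_iff hx₀.1).mpr hev₀
    · exact (hasValueAt_iff (hs (n + 1)).1).mpr (hev n _ (hs n))

/-! ### The action on the tower -/

namespace IsHeightOne

variable {f : ℤ_[p]⟦X⟧} (hf : IsHeightOne f)

include hf

theorem hasResidue_div_self_one_iff {x : PadicAlgCl p} (hx : x ∈ Prim f 0)
    (σ : Gal(PadicAlgCl p/ℚ_[p])) : HasResidue (σ x / x) 1 ↔ σ x = x := by
  have hx0 := hf.ne_zero_of_mem_prim hx
  rw [hasResidue_one_iff, div_sub_one hx0, norm_div, div_lt_one (norm_pos_iff.mpr hx0)]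
  refine ⟨hf.eq_of_mem_prim_zero (galois_mem_prim σ hx) hx, fun h => ?_⟩
  rw [h, sub_self, norm_zero]
  exact norm_pos_iff.mpr hx0

/-- The character is `σ ↦ σ x / x` modulo the maximal ideal. -/
theorem exists_tame_character {x : PadicAlgCl p} (hx : x ∈ Prim f 0)
    (hN : ∀ σ : Gal(PadicAlgCl p/ℚ_[p]), σ x ∈ IntermediateField.adjoin ℚ_[p] {x}) :
    ∃ χ : Gal(PadicAlgCl p/ℚ_[p]) →* ZMod p, ∀ σ, χ σ = 1 ↔ σ x = x := by
  have hx0 := hf.ne_zero_of_mem_prim hx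
  have hres (σ : Gal(PadicAlgCl p/ℚ_[p])) : ∃ a, HasResidue (σ x / x) a := by
    refine hf.exists_hasResidue hx
      (div_mem (hN σ) (IntermediateField.mem_adjoin_simple_self ℚ_[p] x)) ?_
    rw [norm_div, norm_galois, div_self (norm_ne_zero_iff.mpr hx0)]
  choose χ hχ using hres
  have hχ_one (σ : Gal(PadicAlgCl p/ℚ_[p])) : χ σ = 1 ↔ σ x = x := by
    rw [← hf.hasResidue_div_self_one_iff hx]
    exact ⟨fun h => h ▸ hχ σ, (hχ σ).unique⟩
  refine ⟨⟨⟨χ, (hχ_one 1).mpr rfl⟩, fun σ τ => (hχ (σ * τ)).unique ?_⟩, hχ_one⟩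
  have hmul : (σ * τ) x / x = σ x / x * σ (τ x / x) := by
    have hσx : σ x ≠ 0 := (map_ne_zero_iff σ σ.injective).mpr hx0
    rw [AlgEquiv.mul_apply, map_div₀]
    field_simp
  exact hmul ▸ (hχ σ).mul ((hχ τ).galois σ)

theorem exists_tame_generator {x : PadicAlgCl p} (hx : x ∈ Prim f 0)
    (hN : ∀ σ : Gal(PadicAlgCl p/ℚ_[p]), σ x ∈ IntermediateField.adjoin ℚ_[p] {x}) :
    ∃ σ : Gal(PadicAlgCl p/ℚ_[p]), ∀ k : ℕ, (σ ^ k) x = x → p - 1 ∣ k := by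
  obtain ⟨χ, hχ⟩ := hf.exists_tame_character hx hN
  have hindex : (MulAction.stabilizer Gal(PadicAlgCl p/ℚ_[p]) x).index = p - 1 := by
    rw [index_stabilizer, hf.natDegree_minpoly hx, pow_zero, one_mul]
  have : (MulAction.stabilizer Gal(PadicAlgCl p/ℚ_[p]) x).FiniteIndex :=
    ⟨hindex ▸ (Nat.sub_pos_of_lt (Fact.out : p.Prime).one_lt).ne'⟩
  exact hindex ▸ exists_forall_pow_mem_imp_index_dvd (N := MulAction.stabilizer _ x) hχ

theorem exists_galois_eq_ev {u : ℤ_[p]⟦X⟧} (hu : IsUnitCommuting f u) {π : ℕ → PadicAlgCl p}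
    (hπ : IsConsistent f π) :
    ∃ σ : Gal(PadicAlgCl p/ℚ_[p]), ∀ n, σ (π (n + 1)) = ev (π (n + 1)) u := by
  refine exists_forall_mem_of_antitone
    (S := fun n => {σ : Gal(PadicAlgCl p/ℚ_[p]) | σ (π (n + 1)) = ev (π (n + 1)) u})
    (antitone_nat_of_succ_le fun n σ (hσ : σ (π (n + 2)) = ev (π (n + 2)) u) => ?_)
    (fun n => ?_) (fun n => isClosed_setOf_apply_eq _ _)
  · rw [Set.mem_ofPred_eq, ← hπ.ev_succ (n + 1), galois_ev σ (hπ.norm_lt_one _), hσ,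
      hu.comm _ (hπ.norm_lt_one _)]
  · have hx := hπ.mem_prim hf.coeff_zero n
    exact hf.exists_galois_eq hx (hu.ev_mem_prim hf.coeff_zero hx)

variable (hGal : ∀ π ∈ LamAll f, IsGalois ℚ_[p] (IntermediateField.adjoin ℚ_[p] {π}))

include hGal

omit hf in
theorem galois_mem_adjoin_of_mem_prim {n : ℕ} {x : PadicAlgCl p} (hx : x ∈ Prim f n)
    (σ : Gal(PadicAlgCl p/ℚ_[p])) : σ x ∈ IntermediateField.adjoin ℚ_[p] {x} :=
  have := (hGal x (mem_lamAll_of_mem_prim hx)).to_normal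
  apply_mem_adjoin σ

theorem mem_adjoin_of_mem_prim {k n : ℕ} (hk : k ≤ n) {x y : PadicAlgCl p} (hx : x ∈ Prim f n)
    (hy : y ∈ Prim f k) : y ∈ IntermediateField.adjoin ℚ_[p] {x} := by
  induction n, hk using Nat.le_induction generalizing x with
  | base =>
    obtain ⟨σ, rfl⟩ := hf.exists_galois_eq hx hy
    exact galois_mem_adjoin_of_mem_prim hGal hx σ
  | succ n _ ih =>
    exact IntermediateField.adjoin_simple_le_iff.mpr (ev_mem_adjoin hx.1 f)
      (ih (ev_mem_prim hf.coeff_zero hx))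

theorem Kn_succ_eq {n : ℕ} {x : PadicAlgCl p} (hx : x ∈ Prim f n) :
    Kn f (n + 1) = IntermediateField.adjoin ℚ_[p] {x} := by
  refine le_antisymm (IntermediateField.adjoin_le_iff.mpr fun y hy => ?_)
    (IntermediateField.adjoin_simple_le_iff.mpr
      (IntermediateField.subset_adjoin _ _ (mem_lam_of_mem_prim hx)))
  rcases eq_zero_or_mem_prim_of_mem_lam hy with rfl | ⟨k, hk, hyk⟩
  · exact zero_mem _
  · exact hf.mem_adjoin_of_mem_prim hGal (Nat.lt_succ_iff.mp hk) hx hyk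

theorem apply_eq_self_of_mem_prim {n : ℕ} {x y : PadicAlgCl p} (hx : x ∈ Prim f n)
    (hy : y ∈ Prim f n) {σ : Gal(PadicAlgCl p/ℚ_[p])} (hσ : σ x = x) : σ y = y :=
  apply_eq_self_of_mem_adjoin hσ (hf.mem_adjoin_of_mem_prim hGal le_rfl hx hy)

theorem isGalois_Kn (n : ℕ) : IsGalois ℚ_[p] (Kn f (n + 1)) := by
  obtain ⟨x, hx⟩ := hf.prim_nonempty n
  exact hf.Kn_succ_eq hGal hx ▸ hGal x (mem_lamAll_of_mem_prim hx)

theorem finiteDimensional_Kn (n : ℕ) : FiniteDimensional ℚ_[p] (Kn f (n + 1)) := by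
  obtain ⟨x, hx⟩ := hf.prim_nonempty n
  exact hf.Kn_succ_eq hGal hx ▸ finiteDimensional_adjoin_singleton x

theorem card_gal_Kn (n : ℕ) : Nat.card Gal(Kn f (n + 1)/ℚ_[p]) = p ^ n * (p - 1) := by
  have := hf.isGalois_Kn hGal n
  obtain ⟨x, hx⟩ := hf.prim_nonempty n
  have := hf.finiteDimensional_Kn hGal n
  rw [IsGalois.card_aut_eq_finrank, hf.Kn_succ_eq hGal hx, hf.finrank_adjoin hx]

end IsHeightOne

/-- The automorphisms of `K` fixing the `n+1`-st term of a consistent sequence, hence fixing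
`K_{n+1}`. -/
noncomputable def levelStabilizer {f : ℤ_[p]⟦X⟧} {π : ℕ → PadicAlgCl p} (hπ : IsConsistent f π)
    (n : ℕ) : Subgroup Gal(K f/ℚ_[p]) :=
  MulAction.stabilizer Gal(K f/ℚ_[p]) (⟨π (n + 1), hπ.mem_K (n + 1)⟩ : K f)

section LevelStabilizer

variable {f u : ℤ_[p]⟦X⟧} {π : ℕ → PadicAlgCl p} (hπ : IsConsistent f π)

theorem restrictNormalHom_mem_levelStabilizer {n : ℕ} {σ : Gal(PadicAlgCl p/ℚ_[p])} :
    AlgEquiv.restrictNormalHom (K f) σ ∈ levelStabilizer hπ n ↔ σ (π (n + 1)) = π (n + 1) := by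
  rw [levelStabilizer, MulAction.mem_stabilizer_iff, AlgEquiv.smul_def, ← Subtype.coe_inj,
    restrictNormalHom_K_apply]

theorem antitone_levelStabilizer : Antitone (levelStabilizer hπ) := by
  refine antitone_nat_of_succ_le fun n σ hσ => ?_
  obtain ⟨σ, rfl⟩ := AlgEquiv.restrictNormalHom_surjective (PadicAlgCl p) σ
  rw [restrictNormalHom_mem_levelStabilizer] at hσ ⊢
  rw [← hπ.ev_succ (n + 1), galois_ev σ (hπ.norm_lt_one _), hσ]

theorem actsThrough_restrictNormalHom_iff (hu0 : coeff 0 u = 0) {σ : Gal(PadicAlgCl p/ℚ_[p])} :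
    ActsThrough u hπ (AlgEquiv.restrictNormalHom (K f) σ) ↔
      ∀ n, σ (π (n + 1)) = ev (π (n + 1)) u := by
  simp only [ActsThrough, hasValueAt_iff (hπ.norm_lt_one _), restrictNormalHom_K_apply]
  refine ⟨fun h n => (h (n + 1)).symm, fun h n => ?_⟩
  cases n with
  | zero => rw [hπ.zero, ev_zero_left, hu0, map_zero, map_zero]
  | succ n => exact (h n).symm

variable (hf : IsHeightOne f)

include hf

theorem index_levelStabilizer (n : ℕ) : (levelStabilizer hπ n).index = p ^ n * (p - 1) := by
  rw [levelStabilizer, index_stabilizer,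
    ← hf.natDegree_minpoly (hπ.mem_prim hf.coeff_zero n),
    ← minpoly.algebraMap_eq (algebraMap (K f) (PadicAlgCl p)).injective]
  rfl

theorem exists_actsThrough (hu : IsUnitCommuting f u) :
    ∃ σ : Gal(K f/ℚ_[p]), ActsThrough u hπ σ := by
  obtain ⟨σ, hσ⟩ := hf.exists_galois_eq_ev hu hπ
  exact ⟨_, (actsThrough_restrictNormalHom_iff hπ hu.coeff_zero).mpr hσ⟩

variable (hGal : ∀ π ∈ LamAll f, IsGalois ℚ_[p] (IntermediateField.adjoin ℚ_[p] {π}))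

include hGal

theorem normal_levelStabilizer (n : ℕ) : (levelStabilizer hπ n).Normal := by
  refine ⟨fun τ hτ σ => ?_⟩
  obtain ⟨σ, rfl⟩ := AlgEquiv.restrictNormalHom_surjective (PadicAlgCl p) σ
  obtain ⟨τ, rfl⟩ := AlgEquiv.restrictNormalHom_surjective (PadicAlgCl p) τ
  have hx := hπ.mem_prim hf.coeff_zero n
  rw [restrictNormalHom_mem_levelStabilizer] at hτ
  rw [← map_inv, ← map_mul, ← map_mul, restrictNormalHom_mem_levelStabilizer, AlgEquiv.mul_apply,
    AlgEquiv.mul_apply, hf.apply_eq_self_of_mem_prim hGal hx (galois_mem_prim σ⁻¹ hx) hτ,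
    ← AlgEquiv.mul_apply, mul_inv_cancel, AlgEquiv.one_apply]

theorem eq_one_of_forall_mem_levelStabilizer {σ : Gal(K f/ℚ_[p])}
    (hσ : ∀ n, σ ∈ levelStabilizer hπ n) : σ = 1 := by
  obtain ⟨σ, rfl⟩ := AlgEquiv.restrictNormalHom_surjective (PadicAlgCl p) σ
  simp only [restrictNormalHom_mem_levelStabilizer] at hσ
  have hmem : σ ∈ (K f).fixingSubgroup := by
    refine mem_fixingSubgroup_adjoin_iff.mpr fun x hx => ?_
    obtain ⟨n, hn⟩ := Set.mem_iUnion.mp hx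
    rcases eq_zero_or_mem_prim_of_mem_lam hn with rfl | ⟨k, -, hxk⟩
    · exact map_zero σ
    · exact hf.apply_eq_self_of_mem_prim hGal (hπ.mem_prim hf.coeff_zero k) hxk (hσ k)
  rwa [← IntermediateField.restrictNormalHom_ker, MonoidHom.mem_ker] at hmem

theorem eq_of_actsThrough (hu0 : coeff 0 u = 0) {σ τ : Gal(K f/ℚ_[p])}
    (hσ : ActsThrough u hπ σ) (hτ : ActsThrough u hπ τ) : σ = τ := by
  obtain ⟨σ, rfl⟩ := AlgEquiv.restrictNormalHom_surjective (PadicAlgCl p) σ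
  obtain ⟨τ, rfl⟩ := AlgEquiv.restrictNormalHom_surjective (PadicAlgCl p) τ
  rw [actsThrough_restrictNormalHom_iff hπ hu0] at hσ hτ
  refine inv_mul_eq_one.mp (eq_one_of_forall_mem_levelStabilizer hπ hf hGal fun n => ?_)
  rw [← map_inv, ← map_mul, restrictNormalHom_mem_levelStabilizer, AlgEquiv.mul_apply, hτ, ← hσ,
    ← AlgEquiv.mul_apply, inv_mul_cancel, AlgEquiv.one_apply]

theorem isTameWild_levelStabilizer (hodd : Odd p) (hu : IsUnitCommuting f u)
    (h1 : ‖coeff 1 u - 1‖ = (p : ℝ)⁻¹) {υ : Gal(K f/ℚ_[p])} (hυ : ActsThrough u hπ υ) :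
    IsTameWild p (levelStabilizer hπ) υ := by
  have hsurj := AlgEquiv.restrictNormalHom_surjective (F := ℚ_[p]) (K₁ := K f) (PadicAlgCl p)
  have hprim := hπ.mem_prim hf.coeff_zero
  obtain ⟨υ, rfl⟩ := hsurj υ
  rw [actsThrough_restrictNormalHom_iff hπ hu.coeff_zero] at hυ
  refine
    { normal := normal_levelStabilizer hπ hf hGal
      isOpen := fun n => stabilizer_isOpen_of_isIntegral _
      anti := antitone_levelStabilizer hπ
      sep := fun σ => eq_one_of_forall_mem_levelStabilizer hπ hf hGal
      index := index_levelStabilizer hπ hf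
      mem := ?_
      dvd_of_pow_mem := fun n k hk => ?_
      conj := fun σ a ha => ?_
      exists_generator := ?_ }
  · rw [restrictNormalHom_mem_levelStabilizer, hυ, hu.ev_eq_self hf (hprim 0)]
  · rw [← map_pow, restrictNormalHom_mem_levelStabilizer] at hk
    exact hu.pow_dvd_of_galois_pow_eq hf h1 hodd (hprim n) (hυ n) hk
  · obtain ⟨σ, rfl⟩ := hsurj σ
    rw [← map_pow, ← map_inv, ← map_inv, ← map_mul, ← map_mul, ← map_mul,
      restrictNormalHom_mem_levelStabilizer, AlgEquiv.mul_apply, AlgEquiv.aut_inv,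
      AlgEquiv.symm_apply_eq] at ha
    exact hu.dvd_of_conj_eq hf h1 (hprim 1) (hυ 1)
      (IsHeightOne.galois_mem_adjoin_of_mem_prim hGal (hprim 1)) σ ha
  · obtain ⟨σ, hσ⟩ := hf.exists_tame_generator (hprim 0)
      (IsHeightOne.galois_mem_adjoin_of_mem_prim hGal (hprim 0))
    refine ⟨AlgEquiv.restrictNormalHom (K f) σ, fun k hk => hσ k ?_⟩
    rwa [← map_pow, restrictNormalHom_mem_levelStabilizer] at hk

theorem isCyclic_gal_Kn {υ : Gal(K f/ℚ_[p])} (h : IsTameWild p (levelStabilizer hπ) υ) (n : ℕ) :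
    IsCyclic Gal(Kn f (n + 1)/ℚ_[p]) := by
  have := hf.isGalois_Kn hGal n
  have := hf.finiteDimensional_Kn hGal n
  obtain ⟨g, hg⟩ := h.exists_forall_dvd_of_pow_mem
  obtain ⟨σ, rfl⟩ := AlgEquiv.restrictNormalHom_surjective (PadicAlgCl p) g
  have hcard := hf.card_gal_Kn hGal n
  refine isCyclic_of_orderOf_eq_card (AlgEquiv.restrictNormalHom (Kn f (n + 1)) σ) ?_
  refine Nat.dvd_antisymm (orderOf_dvd_natCard _) (hcard ▸ hg n _ ?_)
  rw [← map_pow, restrictNormalHom_mem_levelStabilizer]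
  have hfix := pow_orderOf_eq_one (AlgEquiv.restrictNormalHom (Kn f (n + 1)) σ)
  rw [← map_pow, ← MonoidHom.mem_ker, IntermediateField.restrictNormalHom_ker,
    mem_fixingSubgroup_adjoin_iff] at hfix
  exact hfix _ (mem_lam_of_mem_prim (hπ.mem_prim hf.coeff_zero n))

end LevelStabilizer

theorem nonempty_mulEquiv_of_isCyclic {P : Type*} [Group P] [IsCyclic P] {n : ℕ}
    (hcard : Nat.card P = p ^ n * (p - 1)) :
    Nonempty (P ≃* Multiplicative (ZMod (p - 1)) × Multiplicative (ZMod (p ^ n))) := by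
  have hZ (m : ℕ) : Nat.card (Multiplicative (ZMod m)) = m := Nat.card_zmod m
  have : IsCyclic (Multiplicative (ZMod (p - 1)) × Multiplicative (ZMod (p ^ n))) := by
    rw [Group.isCyclic_prod_iff, hZ, hZ]
    exact ⟨inferInstance, inferInstance, (coprime_prime_sub_one.pow_left n).symm⟩
  exact ⟨mulEquivOfCyclicCardEq (by rw [hcard, Nat.card_prod, hZ, hZ, mul_comm])⟩

theorem norm_eq_inv_of_valuation_eq_one {a : ℤ_[p]} (ha : a.valuation = 1) :
    ‖a‖ = (p : ℝ)⁻¹ := by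
  have ha0 : a ≠ 0 := by
    rintro rfl
    simp at ha
  rw [PadicInt.norm_eq_zpow_neg_valuation ha0, ha, Nat.cast_one, zpow_neg_one]

namespace IsMinimalCommutingPair

variable {f u : ℤ_[p]⟦X⟧} (h : IsMinimalCommutingPair f u)

include h

theorem isHeightOne : IsHeightOne f where
  coeff_zero := h.f_mem.1
  wideg_eq := h.wideg_eq
  norm_coeff_one := norm_eq_inv_of_valuation_eq_one h.valuation_f

theorem norm_coeff_one_sub_one (hp : p ≠ 2) : ‖coeff 1 u - 1‖ = (p : ℝ)⁻¹ :=
  norm_eq_inv_of_valuation_eq_one (h.valuation_u.trans (if_neg hp))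

theorem isUnitCommuting (hp : p ≠ 2) : IsUnitCommuting f u where
  coeff_zero := h.u_mem.1
  dvd_sub_one := by
    rw [← PadicInt.norm_lt_one_iff_dvd, h.norm_coeff_one_sub_one hp]
    exact inv_prime_lt_one
  comm x hx := by rw [← ev_comp hx u h.f_mem.1, ← ev_comp hx f h.u_mem.1, h.comm]

end IsMinimalCommutingPair

end CommutingPair

theorem mainTheorem2 (p : ℕ) [Fact p.Prime] (hp : 2 < p) (f u : PowerSeries ℤ_[p])
    (hfu : IsMinimalCommutingPair f u)
    (hGal : ∀ π ∈ LamAll f, IsGalois ℚ_[p] (IntermediateField.adjoin ℚ_[p] {π})) :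
    -- `K / ℚ_p` is Galois with group topologically isomorphic to `Z_{p-1} × ℤ_p`
    IsGalois ℚ_[p] (K f) ∧
    Nonempty (Gal(K f/ℚ_[p]) ≃ₜ* Multiplicative (ZMod (p - 1)) × Multiplicative ℤ_[p]) ∧
    (∀ σ τ : Gal(K f/ℚ_[p]), σ * τ = τ * σ) ∧
    -- the finite levels
    (∀ n : ℕ, 1 ≤ n → IsGalois ℚ_[p] (Kn f n) ∧
      Nonempty (Gal(Kn f n/ℚ_[p]) ≃*
        Multiplicative (ZMod (p - 1)) × Multiplicative (ZMod (p ^ (n - 1))))) ∧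
    -- the isomorphism is realized by an element of order `p - 1` and the automorphism given by `u`
    (∃ 𝔴 : Gal(K f/ℚ_[p]), orderOf 𝔴 = p - 1) ∧
    (∃ π : ℕ → PadicAlgCl p, IsConsistent f π) ∧
    (∀ (π : ℕ → PadicAlgCl p) (hπ : IsConsistent f π),
      (∃! 𝔲 : Gal(K f/ℚ_[p]), ActsThrough u hπ 𝔲) ∧
      ∀ 𝔲 𝔴 : Gal(K f/ℚ_[p]), ActsThrough u hπ 𝔲 → orderOf 𝔴 = p - 1 →
        𝔴 * 𝔲 = 𝔲 * 𝔴 ∧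
        ∃ φ : Gal(K f/ℚ_[p]) ≃ₜ* Multiplicative (ZMod (p - 1)) × Multiplicative ℤ_[p],
          φ 𝔴 = (Multiplicative.ofAdd 1, 1) ∧ φ 𝔲 = (1, Multiplicative.ofAdd 1)) := by
  have hf := hfu.isHeightOne
  have hu := hfu.isUnitCommuting hp.ne'
  have tameWild {π : ℕ → PadicAlgCl p} (hπ : IsConsistent f π) {𝔲 : Gal(K f/ℚ_[p])}
      (h𝔲 : ActsThrough u hπ 𝔲) : IsTameWild p (levelStabilizer hπ) 𝔲 :=
    isTameWild_levelStabilizer hπ hf hGal ((Fact.out : p.Prime).odd_of_ne_two hp.ne') hu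
      (hfu.norm_coeff_one_sub_one hp.ne') h𝔲
  obtain ⟨π₀, hπ₀⟩ := hf.exists_isConsistent
  obtain ⟨𝔲₀, h𝔲₀⟩ := exists_actsThrough hπ₀ hf hu
  obtain ⟨𝔴₀, h𝔴₀⟩ := (tameWild hπ₀ h𝔲₀).exists_orderOf_eq
  obtain ⟨φ₀, -, -⟩ := (tameWild hπ₀ h𝔲₀).exists_continuousMulEquiv_zmod_prod_padicInt h𝔴₀
  refine ⟨isGalois_K f, ⟨φ₀⟩, fun σ τ => φ₀.injective ?_, fun n hn => ?_, ⟨𝔴₀, h𝔴₀⟩, ⟨π₀, hπ₀⟩,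
    fun π hπ => ⟨?_, fun 𝔲 𝔴 h𝔲 h𝔴 => ⟨?_, ?_⟩⟩⟩
  · rw [map_mul, map_mul, mul_comm]
  · obtain ⟨n, rfl⟩ := Nat.exists_eq_add_of_le' hn
    have := isCyclic_gal_Kn hπ₀ hf hGal (tameWild hπ₀ h𝔲₀) n
    exact ⟨hf.isGalois_Kn hGal n, nonempty_mulEquiv_of_isCyclic (hf.card_gal_Kn hGal n)⟩
  · obtain ⟨𝔲, h𝔲⟩ := exists_actsThrough hπ hf hu
    exact ⟨𝔲, h𝔲, fun 𝔳 h𝔳 => eq_of_actsThrough hπ hf hGal hu.coeff_zero h𝔳 h𝔲⟩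
  · exact (tameWild hπ h𝔲).commute_of_pow_eq_one (h𝔴 ▸ pow_orderOf_eq_one 𝔴)
  · exact (tameWild hπ h𝔲).exists_continuousMulEquiv_zmod_prod_padicInt h𝔴
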